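/- For $f:\mathbb{F}_2^n\to\{0,1\}$ and a set $\mathcal P$ of such functions let $\delta_{\mathcal P}(f)=\min_{g\in\mathcal P}\Pr_x[f(x)\neq g(x)]$ be the distance from $f$ to $\mathcal P$, where $x$ is uniform in $\mathbb{F}_2^n$, and let $\hat f(\alpha)=\mathbb{E}_x[f(x)(-1)^{\alpha\cdot x}]$ for $\alpha\in\mathbb{F}_2^n$. Call $f$ odd-cycle-free (OCF) if for all odd $k\ge 1$ there are no $x_1,\dots,x_k\in\mathbb{F}_2^n$ with $x_1+\cdots+x_k=0$ and $f(x_1)=\cdots=f(x_k)=1$, and call $f$ linear if $f(x+y)=f(x)+f(y)$ in $\mathbb{F}_2$ for all $x,y$. Theorem. There exist a single randomized algorithm and a polynomial $p$ such that the following holds for every $n\ge 0$, every $f:\mathbb{F}_2^n\to\{0,1\}$ and every $\epsilon\in(0,1)$. Given $n$, the parameter $\epsilon$, and oracle access to $f$ (one query returns the value of $f$ at one point chosen by the algorithm), the algorithm always halts after at most $p(1/\epsilon)$ queries and returns three rational numbers. With probability at least $2/3$ over its coin tosses, these are, simultaneously, within $\pm\epsilon$ of the distance from $f$ to the set of OCF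 functions, within $\pm\epsilon$ of $\min_{\alpha\in\mathbb{F}_2^n}\hat f(\alpha)$, and within $\pm\epsilon$ of the distance from $f$ to the set of linear functions, respectively. (The parameter is passed to the algorithm as a fraction $a/b$ of natural numbers with $\epsilon/2\le a/b\le\epsilon$, any such fraction being allowed; for rational $\epsilon$ it can be $\epsilon$ itself.) -/

import Mathlib

/-- The vector space `𝔽₂ⁿ`. -/
abbrev Cube (n : ℕ) : Type := Fin n → ZMod 2

/-- Boolean functions on `𝔽₂ⁿ`; the value `true` stands for `1` and `false` for `0`. -/
abbrev BoolFun (n : ℕ) : Type := Cube n → Bool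

/-! ### Properties of Boolean functions and the distance to them -/

/-- Normalized Hamming distance `δ(f, g) = Pr_x [f x ≠ g x]`, for `x` uniform in `𝔽₂ⁿ`. -/
noncomputable def hammingDelta {n : ℕ} (f g : BoolFun n) : ℝ :=
  (Nat.card {x : Cube n // f x ≠ g x} : ℝ) / 2 ^ n

/-- Distance `δ_P(f) = min_{g ∈ P} δ(f, g)` from `f` to a property `P`
(the infimum runs over a finite set, and it is used for non-empty `P` only). -/
noncomputable def distTo {n : ℕ} (P : Set (BoolFun n)) (f : BoolFun n) : ℝ :=
  ⨅ g : P, hammingDelta f g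

/-- Odd-cycle-freeness: for no odd `k` are there `x₁, …, x_k`, not necessarily distinct, with
`x₁ + ⋯ + x_k = 0` and `f(x₁) = ⋯ = f(x_k) = 1`. -/
def OddCycleFree {n : ℕ} (f : BoolFun n) : Prop :=
  ∀ k : ℕ, Odd k → ¬ ∃ x : Fin k → Cube n, ∑ i, x i = 0 ∧ ∀ i, f (x i) = true

/-- Linearity, `f(x + y) = f(x) + f(y)`; addition of `𝔽₂` on `{0, 1}` is exclusive or. -/
def IsLinearFun {n : ℕ} (f : BoolFun n) : Prop :=
  ∀ x y : Cube n, f (x + y) = xor (f x) (f y)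

/-- Distance to odd-cycle-freeness. -/
noncomputable def distOCF {n : ℕ} (f : BoolFun n) : ℝ := distTo {g | OddCycleFree g} f

/-- Distance to linearity. -/
noncomputable def distLinear {n : ℕ} (f : BoolFun n) : ℝ := distTo {g | IsLinearFun g} f

/-- Fourier coefficient `f̂(α) = E_x [f(x) (-1)^{α · x}]`. -/
noncomputable def fourierCoeff2 {n : ℕ} (f : BoolFun n) (α : Cube n) : ℝ :=
  (∑ x : Cube n, (if f x = true then (1 : ℝ) else 0) * (-1 : ℝ) ^ (α ⬝ᵥ x).val) / 2 ^ n

/-- The smallest Fourier coefficient `min_α f̂(α)` (over the finite non-empty set `𝔽₂ⁿ`). -/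
noncomputable def minFourier {n : ℕ} (f : BoolFun n) : ℝ := ⨅ α : Cube n, fourierCoeff2 f α

/-! ### Randomized oracle algorithms -/

/-- The point of `𝔽₂ⁿ` denoted by a bit string (missing bits are `0`, excess bits are ignored). -/
def pointOfBits (n : ℕ) (l : List Bool) : Cube n :=
  fun i => if l.getD i false = true then 1 else 0

/-- The input of an algorithm: the dimension `n` and an accuracy parameter, which is a rational
number given by numerator and denominator. -/
abbrev AlgInput : Type := ℕ × ℕ × ℕ

/-- A randomized algorithm with oracle access to a Boolean function and outputs in `O`. One and
the same algorithm serves all dimensions and all accuracies. On an input it first computes how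
many coins to toss, and tosses them. From then on it is deterministic and adaptive: from the input,
the coins and the answers received so far, in order, it computes either the next query (`Sum.inl`,
a bit string that denotes a point) or its final output (`Sum.inr`). -/
structure OracleAlgorithm (O : Type) [Primcodable O] where
  /-- number of coin tosses -/
  coins : AlgInput → ℕ
  /-- next action, from the input, the coins and the previous answers -/
  step : AlgInput × List Bool × List Bool → List Bool ⊕ O
  /-- the number of coin tosses is computed by a Turing machine -/
  coins_computable : Computable coins
  /-- the next action is computed by a Turing machine -/
  step_computable : Computable step

namespace OracleAlgorithm

variable {O : Type} [Primcodable O]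

/-- Continue the run of `A` on oracle `f`, when the coins are `w` and the answers `ans` have been
received, for at most `q` more queries; `none` means that a further query is wanted. -/
def runFrom (A : OracleAlgorithm O) (inp : AlgInput) (w : List Bool) (f : List Bool → Bool) :
    ℕ → List Bool → Option O
  | 0, ans =>
    match A.step (inp, w, ans) with
    | Sum.inr o => some o
    | Sum.inl _ => none
  | q + 1, ans =>
    match A.step (inp, w, ans) with
    | Sum.inr o => some o
    | Sum.inl x => runFrom A inp w f q (ans ++ [f x])

/-- `A`, on accuracy `a / b`, oracle `f` and coins `w`, halts with output `o` after at most `q`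
queries to `f`. -/
def HaltsWith (A : OracleAlgorithm O) {n : ℕ} (a b : ℕ) (f : BoolFun n)
    (w : Fin (A.coins (n, a, b)) → Bool) (q : ℕ) (o : O) : Prop :=
  A.runFrom (n, a, b) (List.ofFn w) (fun x => f (pointOfBits n x)) q [] = some o

/-- Probability of an event over the fair independent coins of `A`. -/
noncomputable def coinProb (A : OracleAlgorithm O) (inp : AlgInput)
    (E : (Fin (A.coins inp) → Bool) → Prop) : ℝ :=
  (Nat.card {w : Fin (A.coins inp) → Bool // E w} : ℝ) / 2 ^ A.coins inp

end OracleAlgorithm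

/-- Codes of rational numbers, as they are printed by an algorithm. -/
abbrev RatCode : Type := ℕ × ℕ × ℕ

/-- The rational number `(p - q) / d` with code `(p, q, d)`. -/
noncomputable def RatCode.value (c : RatCode) : ℝ := ((c.1 : ℝ) - (c.2.1 : ℝ)) / (c.2.2 : ℝ)

section
open scoped BigOperators
open Finset

/-! Both distances depend on only two numbers. A function is odd-cycle-free exactly when its support
avoids the kernel of some form `α · x`, which gives the distance (f̂(0) + min f̂)/2 (`distOCF_eq`).
The distance to linearity is min(f̂(0), 1/2 + min f̂) (`distLinear_eq`). So it suffices to estimate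
f̂(0) and min f̂.

Draw a uniform n × t matrix X with 2^t polynomial in 1/ε, query f at X y for every y, and compute
the Fourier coefficients of y ↦ f(X y); the one at αX estimates f̂(α). A union bound over all 2^n
characters would make t grow with n. Instead, the few characters with large coefficients, collected
in a set Z, are controlled one by one through second moments, and all others at once through the
fourth moment. The sum of fourth powers is the mean of F(z₁)F(z₂)F(z₃)F(z₁+z₂+z₃) (`sum_walsh_pow`).
A random subspace reproduces it up to O(2^-t), because X maps independent triples to uniform triples
(`expect_expect_mulVec_le`). Since Z already accounts for nearly all of it, no other coefficient of
the restriction can be large.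

All failure modes are added up in one nonnegative quantity, `subspaceDefect`, whose mean is at most
1/3 (`exists_defect`); Markov's inequality then gives success probability 2/3. -/

/-! ### Characters of 𝔽₂ᵈ, Fourier inversion and moments -/

/-- The nontrivial real character of `𝔽₂`. -/
noncomputable def signChar (a : ZMod 2) : ℝ := (-1) ^ a.val

theorem signChar_zero : signChar 0 = 1 := by simp [signChar]

theorem signChar_one : signChar 1 = -1 := by simp [signChar, ZMod.val_one]

theorem zmod2_eq_zero_or_one (a : ZMod 2) : a = 0 ∨ a = 1 := by
  revert a; decide

theorem signChar_add (a b : ZMod 2) : signChar (a + b) = signChar a * signChar b := by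
  have h : (1 + 1 : ZMod 2) = 0 := by decide
  rcases zmod2_eq_zero_or_one a with rfl | rfl <;> rcases zmod2_eq_zero_or_one b with rfl | rfl <;>
    simp [signChar_zero, signChar_one, h]

theorem abs_signChar (a : ZMod 2) : |signChar a| = 1 := by
  simp [signChar, abs_pow]

theorem signChar_sum {ι : Type*} (s : Finset ι) (a : ι → ZMod 2) :
    signChar (∑ i ∈ s, a i) = ∏ i ∈ s, signChar (a i) := by
  classical
  induction s using Finset.induction_on with
  | empty => simp [signChar_zero]
  | insert i s hi ih => rw [sum_insert hi, prod_insert hi, signChar_add, ih]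

/-- The Fourier coefficient of a real function on `𝔽₂ᵈ`. -/
noncomputable def walsh {d : ℕ} (F : Cube d → ℝ) (α : Cube d) : ℝ :=
  𝔼 x, F x * signChar (α ⬝ᵥ x)

theorem cube_add_self {d : ℕ} (x : Cube d) : x + x = 0 := by
  ext i; exact CharTwo.add_self_eq_zero (x i)

theorem cube_eq_of_add_eq_zero {d : ℕ} {x y : Cube d} (h : x + y = 0) : x = y := by
  have := cube_add_self y
  rw [← this] at h
  exact add_right_cancel h

theorem card_cube (d : ℕ) : Fintype.card (Cube d) = 2 ^ d := by simp [ZMod.card]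

theorem sum_signChar_dotProduct {d : ℕ} (x : Cube d) :
    ∑ α : Cube d, signChar (α ⬝ᵥ x) = if x = 0 then 2 ^ d else 0 := by
  classical
  simp only [dotProduct, signChar_sum]
  rw [← Fintype.prod_sum (fun i a => signChar (a * x i))]
  have h : ∀ i, ∑ a : ZMod 2, signChar (a * x i) = if x i = 0 then 2 else 0 := by
    intro i
    have hu : (univ : Finset (ZMod 2)) = {0, 1} := by decide
    rw [hu, sum_pair (by decide)]
    rcases zmod2_eq_zero_or_one (x i) with h | h <;> simp [h, signChar_zero, signChar_one]
    norm_num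
  simp only [h]
  split_ifs with hx
  · simp [hx]
  · obtain ⟨i, hi⟩ := Function.ne_iff.mp hx
    exact prod_eq_zero (mem_univ i) (by simpa using hi)

theorem walsh_inversion {d : ℕ} (F : Cube d → ℝ) (x : Cube d) :
    ∑ α, walsh F α * signChar (α ⬝ᵥ x) = F x := by
  classical
  simp only [walsh, Fintype.expect_eq_sum_div_card, card_cube, sum_div, sum_mul]
  rw [sum_comm]
  have h : ∀ y : Cube d, ∑ α : Cube d, F y * signChar (α ⬝ᵥ y) / ((2 ^ d : ℕ) : ℝ) *
      signChar (α ⬝ᵥ x) = if y = x then F y else 0 := by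
    intro y
    have : ∀ α : Cube d, F y * signChar (α ⬝ᵥ y) / ((2 ^ d : ℕ) : ℝ) * signChar (α ⬝ᵥ x) =
        F y / 2 ^ d * signChar (α ⬝ᵥ (y + x)) := by
      intro α; rw [dotProduct_add, signChar_add]; push_cast; ring
    simp only [this]
    rw [← mul_sum, sum_signChar_dotProduct]
    by_cases hyx : y = x
    · subst hyx; simp [cube_add_self]
    · have : y + x ≠ 0 := fun h => hyx (cube_eq_of_add_eq_zero h)
      simp [hyx, this]
  rw [sum_congr rfl fun y _ => h y]
  simp

theorem expect_pow_eq_expect_prod {ι : Type*} [Fintype ι] (G : ι → ℝ) (k : ℕ) :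
    (𝔼 x, G x) ^ k = 𝔼 z : Fin k → ι, ∏ i, G (z i) := by
  classical
  simp [Fintype.expect_eq_sum_div_card, div_pow, Fintype.sum_pow]

/-- The moments of the Fourier coefficients. -/
theorem sum_walsh_pow {d : ℕ} (F : Cube d → ℝ) (k : ℕ) :
    ∑ α, walsh F α ^ (k + 1) = 𝔼 z : Fin k → Cube d, (∏ i, F (z i)) * F (∑ i, z i) := by
  have h : ∀ α, walsh F α ^ (k + 1) = 𝔼 z : Fin k → Cube d,
      (∏ i, F (z i)) * (walsh F α * signChar (α ⬝ᵥ ∑ i, z i)) := by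
    intro α
    -- One factor stays a coefficient; the other k become an average over independent points, whose
    -- characters multiply to the character of their sum. Inversion then evaluates the sum over α.
    rw [pow_succ]
    conv_lhs => rw [walsh, expect_pow_eq_expect_prod, expect_mul]
    refine expect_congr rfl fun z _ => ?_
    rw [prod_mul_distrib, dotProduct_sum, signChar_sum]
    rw [walsh]; ring
  simp only [h]
  rw [← expect_sum_comm]
  refine expect_congr rfl fun z _ => ?_
  rw [← mul_sum, walsh_inversion]

theorem fourierCoeff2_eq_walsh {n : ℕ} (f : BoolFun n) (α : Cube n) :
    fourierCoeff2 f α = walsh (fun x => if f x = true then 1 else 0) α := by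
  rw [walsh, Fintype.expect_eq_sum_div_card, card_cube]
  simp [fourierCoeff2, signChar]

/-! ### Averages over the image of a random matrix -/

/-- Shifting the argument of F by h = φ g is a translation in G, so it does not change the average;
averaging over h as well gives the uniform mean on H. -/
theorem expect_comp_surjective {G H : Type*} [AddCommGroup G] [AddCommGroup H] [Fintype G]
    [Fintype H] (φ : G →+ H) (hφ : Function.Surjective φ) (F : H → ℝ) :
    𝔼 x, F (φ x) = 𝔼 h, F h := by
  have h1 : ∀ h : H, 𝔼 x, F (φ x) = 𝔼 x, F (φ x + h) := by
    intro h
    obtain ⟨g, rfl⟩ := hφ h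
    exact (Fintype.expect_equiv (Equiv.addRight g) _ _ (fun x => by simp)).symm
  have h2 : ∀ x : G, 𝔼 h, F (φ x + h) = 𝔼 h, F h := fun x =>
    Fintype.expect_equiv (Equiv.addLeft (φ x)) _ _ (fun h => by simp)
  calc 𝔼 x, F (φ x) = 𝔼 _h : H, 𝔼 x, F (φ x) := (Fintype.expect_const _).symm
    _ = 𝔼 h : H, 𝔼 x, F (φ x + h) := expect_congr rfl fun h _ => h1 h
    _ = 𝔼 x, 𝔼 h, F (φ x + h) := expect_comm _ _ _
    _ = 𝔼 _x : G, 𝔼 h, F h := expect_congr rfl fun x _ => h2 x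
    _ = 𝔼 h, F h := Fintype.expect_const _

/-- Independent vectors can be sent anywhere by a linear map, so X ↦ (X yᵢ) is a surjective
homomorphism and its values are uniform. -/
theorem expect_mulVec_linearIndependent {n t k : ℕ} (y : Fin k → Cube t)
    (hy : LinearIndependent (ZMod 2) y) (F : (Fin k → Cube n) → ℝ) :
    𝔼 X : Matrix (Fin n) (Fin t) (ZMod 2), F (fun i => X.mulVec (y i)) = 𝔼 z, F z := by
  let φ : Matrix (Fin n) (Fin t) (ZMod 2) →+ (Fin k → Cube n) :=
    { toFun := fun X i => X.mulVec (y i)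
      map_zero' := by ext; simp
      map_add' := fun X Y => by ext; simp [Matrix.add_mulVec] }
  refine expect_comp_surjective φ ?_ F
  intro z
  let b := Module.Basis.span hy
  obtain ⟨g, hg⟩ := LinearMap.exists_extend (b.constr (ZMod 2) z)
  refine ⟨LinearMap.toMatrix' g, ?_⟩
  funext i
  have h1 : g (y i) = b.constr (ZMod 2) z (b i) := by
    rw [← hg]; simp [b, Module.Basis.span_apply]
  change (LinearMap.toMatrix' g).mulVec (y i) = z i
  rw [LinearMap.toMatrix'_mulVec, h1, Module.Basis.constr_basis]

theorem expect_not_linearIndependent {t k : ℕ} (hk : k ≤ t) :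
    (open Classical in 𝔼 y : Fin k → Cube t, if LinearIndependent (ZMod 2) y then (0 : ℝ) else 1) =
      1 - ∏ i : Fin k, (1 - 2 ^ (i : ℕ) / 2 ^ t) := by
  classical
  have h := card_linearIndependent (K := ZMod 2) (V := Cube t) (k := k) (by simpa using hk)
  simp only [ZMod.card, Module.finrank_fintype_fun_eq_card, Fintype.card_fin] at h
  rw [Nat.card_eq_fintype_card, Fintype.card_subtype] at h
  have h1 : (∑ y : Fin k → Cube t, if LinearIndependent (ZMod 2) y then (0 : ℝ) else 1) =
      (2 ^ t) ^ k - ∏ i : Fin k, ((2 : ℝ) ^ t - 2 ^ (i : ℕ)) := by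
    have h2 : ∀ y : Fin k → Cube t, (if LinearIndependent (ZMod 2) y then (0 : ℝ) else 1) =
        1 - if LinearIndependent (ZMod 2) y then (1 : ℝ) else 0 := by
      intro y; split_ifs <;> simp
    simp only [h2, sum_sub_distrib, sum_boole]
    rw [h]
    have h3 : ∀ i : Fin k, 2 ^ (i : ℕ) ≤ 2 ^ t :=
      fun i => Nat.pow_le_pow_right (by norm_num) (by omega)
    simp [Nat.cast_sub (h3 _)]
  rw [Fintype.expect_eq_sum_div_card, h1, sub_div]
  have h4 : ∏ i : Fin k, (1 - (2 : ℝ) ^ (i : ℕ) / 2 ^ t) =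
      (∏ i : Fin k, ((2 : ℝ) ^ t - 2 ^ (i : ℕ))) / (2 ^ t) ^ k := by
    have : ∀ i : Fin k, (1 - (2 : ℝ) ^ (i : ℕ) / 2 ^ t) = (2 ^ t - 2 ^ (i : ℕ)) / 2 ^ t := by
      intro i; field_simp
    simp [this, prod_div_distrib]
  rw [h4]
  simp

/-- Averages over a random subspace exceed true averages by little. -/
theorem expect_expect_mulVec_le {n t k : ℕ} (hk : k ≤ t) (F : (Fin k → Cube n) → ℝ) (B : ℝ)
    (hB : ∀ z, F z ≤ 𝔼 z, F z + B) :
    𝔼 X : Matrix (Fin n) (Fin t) (ZMod 2), 𝔼 y : Fin k → Cube t, F (fun i => X.mulVec (y i)) ≤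
      𝔼 z, F z + B * (1 - ∏ i : Fin k, (1 - 2 ^ (i : ℕ) / 2 ^ t)) := by
  classical
  rw [← expect_not_linearIndependent hk, mul_expect, expect_comm]
  rw [← Fintype.expect_const (ι := Fin k → Cube t) (𝔼 z, F z), ← expect_add_distrib]
  -- Independent tuples y contribute exactly the true mean; only dependent ones pay B.
  refine expect_le_expect fun y _ => ?_
  split_ifs with h
  · rw [expect_mulVec_linearIndependent y h]; simp
  · rw [mul_one]
    exact expect_le univ_nonempty fun X _ => hB _

theorem abs_expect_le_of_abs_le {ι : Type*} [Fintype ι] [Nonempty ι] {g : ι → ℝ} {B : ℝ}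
    (hg : ∀ x, |g x| ≤ B) : |𝔼 x, g x| ≤ B :=
  (abs_expect_le _ _).trans (expect_le univ_nonempty fun x _ => hg x)

/-- Chebyshev with pairs: the square is an average over pairs of centred products, which have mean 0
and size at most 4. A pair y is dependent with probability at most 3/2^t, whence 12. -/
theorem expect_expect_mulVec_sub_sq_le {n t : ℕ} (ht : 2 ≤ t) (g : Cube n → ℝ)
    (hg : ∀ x, |g x| ≤ 1) :
    𝔼 X : Matrix (Fin n) (Fin t) (ZMod 2), (𝔼 y, g (X.mulVec y) - 𝔼 x, g x) ^ 2 ≤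
      12 / 2 ^ t := by
  set μ := 𝔼 x, g x with hμ
  have hμ1 : |μ| ≤ 1 := abs_expect_le_of_abs_le hg
  have h0 : 𝔼 x, (g x - μ) = 0 := by
    rw [expect_sub_distrib, Fintype.expect_const, hμ, sub_self]
  let F : (Fin 2 → Cube n) → ℝ := fun z => ∏ i, (g (z i) - μ)
  have hF0 : 𝔼 z, F z = 0 := by
    rw [← expect_pow_eq_expect_prod (fun x => g x - μ), h0]; norm_num
  have hF : ∀ z, F z ≤ 𝔼 z, F z + 4 := by
    intro z
    rw [hF0]
    have h2 : ∀ x, |g x - μ| ≤ 2 := fun x => by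
      have := abs_sub (g x) μ; linarith [hg x]
    have h3 : |F z| ≤ 2 * 2 := by
      simp only [F, Fin.prod_univ_two, abs_mul]
      exact mul_le_mul (h2 _) (h2 _) (abs_nonneg _) (by norm_num)
    linarith [le_abs_self (F z)]
  have h := expect_expect_mulVec_le (t := t) ht F 4 hF
  have h4 : ∀ X : Matrix (Fin n) (Fin t) (ZMod 2), 𝔼 y : Fin 2 → Cube t,
      F (fun i => X.mulVec (y i)) = (𝔼 y, g (X.mulVec y) - μ) ^ 2 := by
    intro X
    have : 𝔼 y, g (X.mulVec y) - μ = 𝔼 y, (g (X.mulVec y) - μ) := by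
      rw [expect_sub_distrib, Fintype.expect_const]
    rw [this, expect_pow_eq_expect_prod]
  simp only [h4, hF0] at h
  refine h.trans ?_
  simp only [Fin.prod_univ_two, Fin.val_zero, Fin.val_one, pow_zero, pow_one, zero_add]
  have hN : (0 : ℝ) < 1 / 2 ^ t := by positivity
  have e1 : (2 : ℝ) / 2 ^ t = 2 * (1 / 2 ^ t) := by ring
  have e2 : (12 : ℝ) / 2 ^ t = 12 * (1 / 2 ^ t) := by ring
  rw [e1, e2]
  nlinarith [mul_pos hN hN]

/-- The one-point case, applied to -c g to reverse the inequality: the only dependent one-point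
tuple is y = 0, of probability 1/2^t. -/
theorem le_expect_expect_mulVec_mul {n t : ℕ} (ht : 1 ≤ t) (g : Cube n → ℝ)
    (hg : ∀ x, |g x| ≤ 1) (c : ℝ) :
    c * 𝔼 x, g x - 2 * |c| / 2 ^ t ≤
      𝔼 X : Matrix (Fin n) (Fin t) (ZMod 2), c * 𝔼 y, g (X.mulVec y) := by
  let F : (Fin 1 → Cube n) → ℝ := fun z => -c * ∏ i, g (z i)
  have hF0 : 𝔼 z, F z = -c * 𝔼 x, g x := by
    rw [← mul_expect, ← expect_pow_eq_expect_prod, pow_one]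
  have hμ1 : |𝔼 x, g x| ≤ 1 := abs_expect_le_of_abs_le hg
  have hF : ∀ z, F z ≤ 𝔼 z, F z + 2 * |c| := by
    intro z
    rw [hF0]
    simp only [F, Fin.prod_univ_one]
    have h1 : -c * (g (z 0) - 𝔼 x, g x) ≤ |c| * 2 := by
      refine (le_abs_self _).trans ?_
      rw [abs_mul, abs_neg]
      refine mul_le_mul_of_nonneg_left ?_ (abs_nonneg _)
      have := abs_sub (g (z 0)) (𝔼 x, g x)
      linarith [hg (z 0)]
    linarith
  have h := expect_expect_mulVec_le (t := t) ht F (2 * |c|) hF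
  have h4 : ∀ X : Matrix (Fin n) (Fin t) (ZMod 2), 𝔼 y : Fin 1 → Cube t,
      F (fun i => X.mulVec (y i)) = -(c * 𝔼 y, g (X.mulVec y)) := by
    intro X
    simp only [F]
    rw [← mul_expect, ← expect_pow_eq_expect_prod (fun y => g (X.mulVec y)), pow_one]
    ring
  simp only [h4, hF0, expect_neg_distrib] at h
  simp only [Fin.prod_univ_one, Fin.val_zero, pow_zero] at h
  have e : 2 * |c| / 2 ^ t = 2 * |c| * (1 - (1 - 1 / 2 ^ t)) := by ring
  linarith

/-! ### Fourier coefficients of the restriction -/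

/-- The empirical Fourier coefficient of `F` on the image of the matrix `X`. -/
noncomputable def walshRestrict {n t : ℕ} (F : Cube n → ℝ) (X : Matrix (Fin n) (Fin t) (ZMod 2))
    (α : Cube n) : ℝ :=
  𝔼 y : Cube t, F (X.mulVec y) * signChar (α ⬝ᵥ X.mulVec y)

/-- Characters with the same αX share one empirical coefficient; this is why collisions must be
tracked. -/
theorem walshRestrict_eq_walsh {n t : ℕ} (F : Cube n → ℝ) (X : Matrix (Fin n) (Fin t) (ZMod 2))
    (α : Cube n) :
    walshRestrict F X α = walsh (fun y => F (X.mulVec y)) (Matrix.vecMul α X) := by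
  simp [walshRestrict, walsh, Matrix.dotProduct_mulVec]

theorem abs_mul_signChar_le {n : ℕ} {F : Cube n → ℝ} (hF : ∀ x, |F x| ≤ 1) (α x : Cube n) :
    |F x * signChar (α ⬝ᵥ x)| ≤ 1 := by
  rw [abs_mul, abs_signChar, mul_one]; exact hF x

theorem expect_signChar_dotProduct {n : ℕ} {δ : Cube n} (hδ : δ ≠ 0) :
    𝔼 x : Cube n, signChar (δ ⬝ᵥ x) = 0 := by
  rw [Fintype.expect_eq_sum_div_card]
  simp_rw [dotProduct_comm δ]
  rw [sum_signChar_dotProduct, if_neg hδ, zero_div]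

theorem expect_collision_le {n t : ℕ} (ht : 2 ≤ t) {δ : Cube n} (hδ : δ ≠ 0) :
    𝔼 X : Matrix (Fin n) (Fin t) (ZMod 2), (𝔼 y, signChar (δ ⬝ᵥ X.mulVec y)) ^ 2 ≤
      12 / 2 ^ t := by
  have h := expect_expect_mulVec_sub_sq_le ht (fun x : Cube n => signChar (δ ⬝ᵥ x))
    (fun x => (abs_signChar _).le)
  simpa [expect_signChar_dotProduct hδ] using h

theorem expect_walshRestrict_sub_sq_le {n t : ℕ} (ht : 2 ≤ t) {F : Cube n → ℝ}
    (hF : ∀ x, |F x| ≤ 1) (α : Cube n) :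
    𝔼 X : Matrix (Fin n) (Fin t) (ZMod 2), (walshRestrict F X α - walsh F α) ^ 2 ≤ 12 / 2 ^ t := by
  have h := expect_expect_mulVec_sub_sq_le ht (fun x => F x * signChar (α ⬝ᵥ x))
    (abs_mul_signChar_le hF α)
  simpa only [walshRestrict, walsh] using h

theorem abs_walsh_le_one {d : ℕ} {F : Cube d → ℝ} (hF : ∀ x, |F x| ≤ 1) (α : Cube d) :
    |walsh F α| ≤ 1 :=
  abs_expect_le_of_abs_le (abs_mul_signChar_le hF α)

/-- The tangent line to the convex function a ↦ a⁴ at b. It reduces the lower bound on a mean fourth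
power to a first moment. -/
theorem four_mul_sub_le_pow_four (a b : ℝ) : 4 * b ^ 3 * a - 3 * b ^ 4 ≤ a ^ 4 := by
  have h : 0 ≤ (a - b) ^ 2 * ((a + b) ^ 2 + 2 * b ^ 2) := by positivity
  linarith

theorem walsh_pow_four_le_expect {n t : ℕ} (ht : 2 ≤ t) {F : Cube n → ℝ}
    (hF : ∀ x, |F x| ≤ 1) (α : Cube n) :
    walsh F α ^ 4 - 8 / 2 ^ t ≤
      𝔼 X : Matrix (Fin n) (Fin t) (ZMod 2), walshRestrict F X α ^ 4 := by
  have hb : |walsh F α| ≤ 1 := abs_walsh_le_one hF α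
  have h : 4 * walsh F α ^ 3 * walsh F α - 2 * |4 * walsh F α ^ 3| / 2 ^ t ≤
      𝔼 X : Matrix (Fin n) (Fin t) (ZMod 2), 4 * walsh F α ^ 3 * walshRestrict F X α :=
    le_expect_expect_mulVec_mul (by omega) _ (abs_mul_signChar_le hF α) _
  generalize walsh F α = b at *
  have h2 : 𝔼 X : Matrix (Fin n) (Fin t) (ZMod 2),
      (4 * b ^ 3 * walshRestrict F X α - 3 * b ^ 4) ≤
      𝔼 X : Matrix (Fin n) (Fin t) (ZMod 2), walshRestrict F X α ^ 4 :=
    expect_le_expect fun X _ => four_mul_sub_le_pow_four _ _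
  rw [expect_sub_distrib, Fintype.expect_const] at h2
  have h3 : 2 * |4 * b ^ 3| / 2 ^ t ≤ 8 / (2 : ℝ) ^ t := by
    refine div_le_div_of_nonneg_right ?_ (by positivity)
    rw [abs_mul, abs_pow]
    have := pow_le_one₀ (n := 3) (abs_nonneg b) hb
    norm_num; linarith
  have h5 : 4 * b ^ 3 * b = 4 * b ^ 4 := by ring
  linarith

/-- By linearity of X the restricted fourth moment is the same triple average, taken at points of
the subspace. A triple is dependent with probability at most (1 + 2 + 4)/2^t. -/
theorem expect_sum_walsh_pow_four_le {n t : ℕ} (ht : 3 ≤ t) {F : Cube n → ℝ}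
    (hF0 : ∀ x, 0 ≤ F x) (hF1 : ∀ x, F x ≤ 1) :
    𝔼 X : Matrix (Fin n) (Fin t) (ZMod 2), ∑ β, walsh (fun y => F (X.mulVec y)) β ^ 4 ≤
      ∑ α, walsh F α ^ 4 + 7 / 2 ^ t := by
  let G : (Fin 3 → Cube n) → ℝ := fun z => (∏ i, F (z i)) * F (∑ i, z i)
  have hG0 : ∀ z, 0 ≤ G z := fun z => mul_nonneg (prod_nonneg fun i _ => hF0 _) (hF0 _)
  have hG1 : ∀ z, G z ≤ 1 := fun z =>
    mul_le_one₀ (prod_le_one (fun i _ => hF0 _) fun i _ => hF1 _) (hF0 _) (hF1 _)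
  have hG : ∀ z, G z ≤ 𝔼 z, G z + 1 := fun z => by
    have : 0 ≤ 𝔼 z, G z := expect_nonneg fun z _ => hG0 z
    linarith [hG1 z]
  have h := expect_expect_mulVec_le (t := t) ht G 1 hG
  have h1 : ∀ X : Matrix (Fin n) (Fin t) (ZMod 2), ∑ β, walsh (fun y => F (X.mulVec y)) β ^ 4 =
      𝔼 y : Fin 3 → Cube t, G (fun i => X.mulVec (y i)) := by
    intro X
    rw [sum_walsh_pow _ 3]
    refine expect_congr rfl fun y _ => ?_
    simp only [G]
    congr 2
    simp [Fin.sum_univ_three, Matrix.mulVec_add]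
  simp only [h1]
  rw [sum_walsh_pow _ 3]
  refine h.trans (add_le_add le_rfl ?_)
  simp only [Fin.prod_univ_three, Fin.val_zero, Fin.val_one, Fin.val_two, pow_zero, pow_one]
  have hN : (0 : ℝ) < 1 / 2 ^ t := by positivity
  have hN1 : (1 : ℝ) / 2 ^ t ≤ 1 := by
    rw [div_le_one (by positivity)]; exact one_le_pow₀ (by norm_num)
  have e1 : (2 : ℝ) / 2 ^ t = 2 * (1 / 2 ^ t) := by ring
  have e2 : (2 : ℝ) ^ 2 / 2 ^ t = 4 * (1 / 2 ^ t) := by ring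
  have e3 : (7 : ℝ) / 2 ^ t = 7 * (1 / 2 ^ t) := by ring
  rw [e1, e2, e3]
  nlinarith [mul_nonneg (mul_pos hN hN).le (sub_nonneg.mpr hN1), mul_pos hN hN]

/-! ### The defect of a subspace -/

/-- The fourth moment of the restriction of `F` not accounted for by the characters in `Z`. -/
noncomputable def residualFourth {n t : ℕ} (F : Cube n → ℝ) (Z : Finset (Cube n))
    (X : Matrix (Fin n) (Fin t) (ZMod 2)) : ℝ :=
  ∑ β, walsh (fun y => F (X.mulVec y)) β ^ 4 - ∑ α ∈ Z, walshRestrict F X α ^ 4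

/-- The indicator of the event that `δ` is trivial on the image of `X`. -/
noncomputable def trivialOn {n t : ℕ} (X : Matrix (Fin n) (Fin t) (ZMod 2)) (δ : Cube n) : ℝ :=
  (𝔼 y, signChar (δ ⬝ᵥ X.mulVec y)) ^ 2

theorem trivialOn_nonneg {n t : ℕ} (X : Matrix (Fin n) (Fin t) (ZMod 2)) (δ : Cube n) :
    0 ≤ trivialOn X δ := sq_nonneg _

theorem trivialOn_eq_one {n t : ℕ} {X : Matrix (Fin n) (Fin t) (ZMod 2)} {δ : Cube n}
    (h : Matrix.vecMul δ X = 0) : trivialOn X δ = 1 := by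
  rw [trivialOn]
  simp only [Matrix.dotProduct_mulVec, h, zero_dotProduct, signChar_zero]
  rw [Fintype.expect_const, one_pow]

/-- The number of ordered pairs of characters in `Z` that agree on the image of `X`. -/
noncomputable def collisions {n t : ℕ} (Z : Finset (Cube n))
    (X : Matrix (Fin n) (Fin t) (ZMod 2)) : ℝ :=
  ∑ p ∈ Z.offDiag, trivialOn X (p.1 + p.2)

/-- The squared error of the empirical Fourier coefficients in `Z`. -/
noncomputable def squaredError {n t : ℕ} (F : Cube n → ℝ) (Z : Finset (Cube n))
    (X : Matrix (Fin n) (Fin t) (ZMod 2)) : ℝ :=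
  ∑ α ∈ Z, (walshRestrict F X α - walsh F α) ^ 2

section
variable {n t : ℕ} {F : Cube n → ℝ} {Z : Finset (Cube n)} {X : Matrix (Fin n) (Fin t) (ZMod 2)}

theorem collisions_nonneg : 0 ≤ collisions Z X := sum_nonneg fun _ _ => trivialOn_nonneg _ _

theorem squaredError_nonneg : 0 ≤ squaredError F Z X := sum_nonneg fun _ _ => sq_nonneg _

theorem one_le_collisions (h : ¬ Set.InjOn (fun α => Matrix.vecMul α X) (Z : Set (Cube n))) :
    1 ≤ collisions Z X := by
  simp only [Set.InjOn, not_forall] at h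
  obtain ⟨α, hα, β, hβ, hXY, hne⟩ := h
  have hmem : (α, β) ∈ Z.offDiag := mem_offDiag.mpr ⟨hα, hβ, hne⟩
  have h1 : trivialOn X (α + β) = 1 := by
    have hXY' : Matrix.vecMul α X = Matrix.vecMul β X := hXY
    exact trivialOn_eq_one (by rw [Matrix.add_vecMul, hXY', cube_add_self])
  have h2 := single_le_sum (f := fun p : Cube n × Cube n => trivialOn X (p.1 + p.2))
    (fun _ _ => trivialOn_nonneg _ _) hmem
  exact h1.symm.le.trans h2

theorem sum_walshRestrict_pow_four_eq [DecidableEq (Cube t)]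
    (h : Set.InjOn (fun α => Matrix.vecMul α X) (Z : Set (Cube n))) :
    ∑ α ∈ Z, walshRestrict F X α ^ 4 =
      ∑ β ∈ Z.image (fun α => Matrix.vecMul α X), walsh (fun y => F (X.mulVec y)) β ^ 4 := by
  rw [sum_image h]
  simp [walshRestrict_eq_walsh]

theorem residualFourth_nonneg
    (h : Set.InjOn (fun α => Matrix.vecMul α X) (Z : Set (Cube n))) :
    0 ≤ residualFourth F Z X := by
  classical
  rw [residualFourth, sum_walshRestrict_pow_four_eq h, sub_nonneg]
  exact sum_le_sum_of_subset_of_nonneg (subset_univ _) fun _ _ _ => by positivity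

/-- Without collisions the residual is a sum of fourth powers over the β outside the image of Z, so
it dominates each of its terms. -/
theorem walshRestrict_pow_four_le_residualFourth [DecidableEq (Cube t)]
    (h : Set.InjOn (fun α => Matrix.vecMul α X) (Z : Set (Cube n))) {α : Cube n}
    (hα : Matrix.vecMul α X ∉ Z.image (fun α => Matrix.vecMul α X)) :
    walshRestrict F X α ^ 4 ≤ residualFourth F Z X := by
  rw [residualFourth, sum_walshRestrict_pow_four_eq h, walshRestrict_eq_walsh, le_sub_iff_add_le,
    ← sum_insert (f := fun β => walsh (fun y => F (X.mulVec y)) β ^ 4) hα]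
  exact sum_le_sum_of_subset_of_nonneg (subset_univ _) fun _ _ _ => by positivity

theorem abs_walshRestrict_le_one (hF : ∀ x, |F x| ≤ 1) (α : Cube n) :
    |walshRestrict F X α| ≤ 1 :=
  abs_expect_le_of_abs_le fun y => abs_mul_signChar_le hF α (X.mulVec y)

/-- Under collisions a coefficient may be subtracted several times and the residual may be negative;
this limits the damage. -/
theorem neg_card_le_residualFourth (hF : ∀ x, |F x| ≤ 1) :
    -(Z.card : ℝ) ≤ residualFourth F Z X := by
  have h1 : ∑ α ∈ Z, walshRestrict F X α ^ 4 ≤ ∑ α ∈ Z, (1 : ℝ) := by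
    refine sum_le_sum fun α _ => ?_
    have h := pow_le_one₀ (n := 4) (abs_nonneg _) (abs_walshRestrict_le_one (X := X) hF α)
    rwa [← abs_pow, abs_of_nonneg (by positivity)] at h
  have h2 : 0 ≤ ∑ β, walsh (fun y => F (X.mulVec y)) β ^ 4 := sum_nonneg fun _ _ => by positivity
  rw [residualFourth]
  simp at h1
  linarith

/-- A nonnegative quantity whose smallness guarantees that the restriction to the image of `X`
represents all Fourier coefficients of `F`. -/
noncomputable def subspaceDefect (F : Cube n → ℝ) (Z : Finset (Cube n)) (K τ η : ℝ)
    (X : Matrix (Fin n) (Fin t) (ZMod 2)) : ℝ :=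
  residualFourth F Z X / τ ^ 4 + (K / τ ^ 4 + 1) * collisions Z X + squaredError F Z X / η ^ 2

/-- The weight K/τ⁴ + 1 is chosen so that a single collision outweighs the worst residual -K/τ⁴ and
still leaves 1. Thus the defect is nonnegative, and less than 1 only without collisions. -/
theorem subspaceDefect_nonneg {K τ η : ℝ} (hF : ∀ x, |F x| ≤ 1) (hK : (Z.card : ℝ) ≤ K) :
    0 ≤ subspaceDefect F Z K τ η X := by
  have hK0 : 0 ≤ K := (Nat.cast_nonneg _).trans hK
  have h1 : 0 ≤ squaredError F Z X / η ^ 2 := div_nonneg squaredError_nonneg (sq_nonneg _)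
  have h3 : 0 ≤ K / τ ^ 4 := by positivity
  have h2 : 0 ≤ residualFourth F Z X / τ ^ 4 + (K / τ ^ 4 + 1) * collisions Z X := by
    by_cases h : Set.InjOn (fun α => Matrix.vecMul α X) (Z : Set (Cube n))
    · have := div_nonneg (residualFourth_nonneg (F := F) h) (by positivity : 0 ≤ τ ^ 4)
      have := mul_nonneg (by linarith : 0 ≤ K / τ ^ 4 + 1) (collisions_nonneg (Z := Z) (X := X))
      linarith
    · have h4 := one_le_collisions h
      have h5 : -K / τ ^ 4 ≤ residualFourth F Z X / τ ^ 4 :=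
        div_le_div_of_nonneg_right (by linarith [neg_card_le_residualFourth (Z := Z) (X := X) hF])
          (by positivity)
      have h6 : (K / τ ^ 4 + 1) * 1 ≤ (K / τ ^ 4 + 1) * collisions Z X :=
        mul_le_mul_of_nonneg_left h4 (by linarith)
      rw [neg_div] at h5
      linarith
  rw [subspaceDefect]; linarith

theorem injOn_of_subspaceDefect_lt_one {K τ η : ℝ} (hF : ∀ x, |F x| ≤ 1)
    (hK : (Z.card : ℝ) ≤ K) (h : subspaceDefect F Z K τ η X < 1) :
    Set.InjOn (fun α => Matrix.vecMul α X) (Z : Set (Cube n)) := by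
  by_contra hinj
  have hK0 : 0 ≤ K := (Nat.cast_nonneg _).trans hK
  have h1 : 0 ≤ squaredError F Z X / η ^ 2 := div_nonneg squaredError_nonneg (sq_nonneg _)
  have h3 : 0 ≤ K / τ ^ 4 := by positivity
  have h4 := one_le_collisions hinj
  have h5 : -K / τ ^ 4 ≤ residualFourth F Z X / τ ^ 4 :=
    div_le_div_of_nonneg_right (by linarith [neg_card_le_residualFourth (Z := Z) (X := X) hF])
      (by positivity)
  have h6 : (K / τ ^ 4 + 1) * 1 ≤ (K / τ ^ 4 + 1) * collisions Z X :=
    mul_le_mul_of_nonneg_left h4 (by linarith)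
  rw [neg_div] at h5
  rw [subspaceDefect] at h
  linarith

theorem abs_walshRestrict_sub_le {K τ η : ℝ} (hF : ∀ x, |F x| ≤ 1) (hη : 0 < η)
    (hK : (Z.card : ℝ) ≤ K) (h : subspaceDefect F Z K τ η X < 1) {α : Cube n} (hα : α ∈ Z) :
    |walshRestrict F X α - walsh F α| ≤ η := by
  have hinj := injOn_of_subspaceDefect_lt_one hF hK h
  have hK0 : 0 ≤ K := (Nat.cast_nonneg _).trans hK
  have h1 := div_nonneg (residualFourth_nonneg (F := F) hinj) (by positivity : 0 ≤ τ ^ 4)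
  have h2 := mul_nonneg (by positivity : 0 ≤ K / τ ^ 4 + 1) (collisions_nonneg (Z := Z) (X := X))
  have h3 : squaredError F Z X / η ^ 2 < 1 := by rw [subspaceDefect] at h; linarith
  rw [div_lt_one (by positivity)] at h3
  have h4 : (walshRestrict F X α - walsh F α) ^ 2 ≤ squaredError F Z X :=
    single_le_sum (f := fun α => (walshRestrict F X α - walsh F α) ^ 2)
      (fun _ _ => sq_nonneg _) hα
  exact abs_le_of_sq_le_sq (h4.trans h3.le) hη.le

/-- On a good subspace every empirical coefficient either comes from `Z` or is small. -/
theorem exists_mem_eq_or_abs_walshRestrict_le {K τ η : ℝ} (hF : ∀ x, |F x| ≤ 1) (hτ : 0 < τ)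
    (hK : (Z.card : ℝ) ≤ K) (h : subspaceDefect F Z K τ η X < 1) (α : Cube n) :
    (∃ β ∈ Z, walshRestrict F X β = walshRestrict F X α) ∨
      α ∉ Z ∧ |walshRestrict F X α| ≤ τ := by
  classical
  have hinj := injOn_of_subspaceDefect_lt_one hF hK h
  by_cases hα : Matrix.vecMul α X ∈ Z.image (fun α => Matrix.vecMul α X)
  · obtain ⟨β, hβ, hβα⟩ := mem_image.mp hα
    exact Or.inl ⟨β, hβ, by simp only [walshRestrict_eq_walsh, hβα]⟩
  · refine Or.inr ⟨fun hZ => hα (mem_image_of_mem _ hZ), ?_⟩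
    have hK0 : 0 ≤ K := (Nat.cast_nonneg _).trans hK
    have h1 : 0 ≤ squaredError F Z X / η ^ 2 := div_nonneg squaredError_nonneg (sq_nonneg _)
    have h2 := mul_nonneg (by positivity : 0 ≤ K / τ ^ 4 + 1) (collisions_nonneg (Z := Z) (X := X))
    have h3 : residualFourth F Z X / τ ^ 4 < 1 := by rw [subspaceDefect] at h; linarith
    rw [div_lt_one (by positivity)] at h3
    have h4 := (walshRestrict_pow_four_le_residualFourth (F := F) hinj hα).trans h3.le
    refine le_of_pow_le_pow_left₀ (n := 4) (by norm_num) hτ.le ?_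
    rwa [← abs_pow, abs_of_nonneg (by positivity)]

end

/-! ### The mean of the defect -/

theorem sum_walsh_sq_le_one {d : ℕ} {F : Cube d → ℝ} (hF0 : ∀ x, 0 ≤ F x)
    (hF1 : ∀ x, F x ≤ 1) : ∑ α, walsh F α ^ 2 ≤ 1 := by
  rw [sum_walsh_pow F 1]
  refine expect_le univ_nonempty fun z _ => ?_
  exact mul_le_one₀ (prod_le_one (fun i _ => hF0 _) fun i _ => hF1 _) (hF0 _) (hF1 _)

/-- The errors of the two fourth-moment comparisons add up; what remains is the true fourth moment
outside Z, at most γ² by Parseval. -/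
theorem expect_residualFourth_le {n t : ℕ} (ht : 3 ≤ t) {F : Cube n → ℝ}
    (hF0 : ∀ x, 0 ≤ F x) (hF1 : ∀ x, F x ≤ 1) {Z : Finset (Cube n)} {γ : ℝ}
    (hγ : ∀ α ∉ Z, |walsh F α| ≤ γ) :
    𝔼 X : Matrix (Fin n) (Fin t) (ZMod 2), residualFourth F Z X ≤
      γ ^ 2 + 7 / 2 ^ t + Z.card * (8 / 2 ^ t) := by
  classical
  have hF : ∀ x, |F x| ≤ 1 := fun x => by rw [abs_of_nonneg (hF0 x)]; exact hF1 x
  simp only [residualFourth]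
  rw [expect_sub_distrib, expect_sum_comm _ Z]
  have h1 := expect_sum_walsh_pow_four_le ht hF0 hF1
  have h2 : ∑ α ∈ Z, walsh F α ^ 4 - Z.card * (8 / 2 ^ t) ≤
      ∑ α ∈ Z, 𝔼 X : Matrix (Fin n) (Fin t) (ZMod 2), walshRestrict F X α ^ 4 := by
    have := sum_le_sum fun α (_ : α ∈ Z) => walsh_pow_four_le_expect (t := t) (by omega) hF α
    rwa [sum_sub_distrib, sum_const, nsmul_eq_mul] at this
  have h3 : ∑ α, walsh F α ^ 2 ≤ 1 := sum_walsh_sq_le_one hF0 hF1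
  have h4 : ∑ α ∈ Zᶜ, walsh F α ^ 4 ≤ γ ^ 2 := by
    calc ∑ α ∈ Zᶜ, walsh F α ^ 4 ≤ ∑ α ∈ Zᶜ, γ ^ 2 * walsh F α ^ 2 := by
          refine sum_le_sum fun α hα => ?_
          have h5 := pow_le_pow_left₀ (abs_nonneg _) (hγ α (mem_compl.mp hα)) 2
          rw [sq_abs] at h5
          calc walsh F α ^ 4 = walsh F α ^ 2 * walsh F α ^ 2 := by ring
            _ ≤ _ := mul_le_mul_of_nonneg_right h5 (sq_nonneg _)
      _ = γ ^ 2 * ∑ α ∈ Zᶜ, walsh F α ^ 2 := by rw [mul_sum]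
      _ ≤ γ ^ 2 * 1 := by
          refine mul_le_mul_of_nonneg_left (le_trans ?_ h3) (sq_nonneg _)
          exact sum_le_sum_of_subset_of_nonneg (subset_univ _) fun _ _ _ => sq_nonneg _
      _ = γ ^ 2 := mul_one _
  have h5 := sum_add_sum_compl Z fun α => walsh F α ^ 4
  linarith

theorem expect_collisions_le {n t : ℕ} (ht : 2 ≤ t) (Z : Finset (Cube n)) :
    𝔼 X : Matrix (Fin n) (Fin t) (ZMod 2), collisions Z X ≤ Z.card ^ 2 * (12 / 2 ^ t) := by
  simp only [collisions]
  rw [expect_sum_comm]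
  have h1 : ∀ p ∈ Z.offDiag, 𝔼 X : Matrix (Fin n) (Fin t) (ZMod 2),
      trivialOn X (p.1 + p.2) ≤ 12 / 2 ^ t := by
    intro p hp
    exact expect_collision_le ht fun h => (mem_offDiag.mp hp).2.2 (cube_eq_of_add_eq_zero h)
  refine (sum_le_sum h1).trans ?_
  rw [sum_const, nsmul_eq_mul]
  refine mul_le_mul_of_nonneg_right ?_ (by positivity)
  have : Z.offDiag.card ≤ Z.card ^ 2 := by rw [offDiag_card, sq]; omega
  exact_mod_cast this

theorem expect_squaredError_le {n t : ℕ} (ht : 2 ≤ t) {F : Cube n → ℝ}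
    (hF : ∀ x, |F x| ≤ 1) (Z : Finset (Cube n)) :
    𝔼 X : Matrix (Fin n) (Fin t) (ZMod 2), squaredError F Z X ≤ Z.card * (12 / 2 ^ t) := by
  simp only [squaredError]
  rw [expect_sum_comm]
  refine (sum_le_sum fun α _ => expect_walshRestrict_sub_sq_le ht hF α).trans ?_
  rw [sum_const, nsmul_eq_mul]

theorem expect_subspaceDefect_le {n t : ℕ} (ht : 3 ≤ t) {F : Cube n → ℝ}
    (hF0 : ∀ x, 0 ≤ F x) (hF1 : ∀ x, F x ≤ 1) {Z : Finset (Cube n)} {γ K τ η : ℝ}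
    (hγ : ∀ α ∉ Z, |walsh F α| ≤ γ) (hK : (Z.card : ℝ) ≤ K) :
    𝔼 X : Matrix (Fin n) (Fin t) (ZMod 2), subspaceDefect F Z K τ η X ≤
      (γ ^ 2 + 7 / 2 ^ t + K * (8 / 2 ^ t)) / τ ^ 4 + (K / τ ^ 4 + 1) * (K ^ 2 * (12 / 2 ^ t)) +
        K * (12 / 2 ^ t) / η ^ 2 := by
  have hF : ∀ x, |F x| ≤ 1 := fun x => by rw [abs_of_nonneg (hF0 x)]; exact hF1 x
  have hK0 : 0 ≤ K := (Nat.cast_nonneg _).trans hK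
  simp only [subspaceDefect]
  rw [expect_add_distrib, expect_add_distrib, ← mul_expect, ← expect_div, ← expect_div]
  have h1 := expect_residualFourth_le ht hF0 hF1 hγ
  have h2 := expect_collisions_le (t := t) (by omega) Z
  have h3 := expect_squaredError_le (t := t) (by omega) hF Z
  gcongr
  · refine h1.trans ?_; gcongr
  · refine h2.trans ?_; gcongr
  · refine h3.trans ?_; gcongr

/-! ### Boolean functions and the choice of parameters -/

/-- The real-valued version of a Boolean function. -/
noncomputable def boolReal {n : ℕ} (f : BoolFun n) (x : Cube n) : ℝ := if f x = true then 1 else 0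

theorem boolReal_nonneg {n : ℕ} (f : BoolFun n) (x : Cube n) : 0 ≤ boolReal f x := by
  rw [boolReal]; split_ifs <;> norm_num

theorem boolReal_le_one {n : ℕ} (f : BoolFun n) (x : Cube n) : boolReal f x ≤ 1 := by
  rw [boolReal]; split_ifs <;> norm_num

theorem abs_boolReal_le_one {n : ℕ} (f : BoolFun n) (x : Cube n) : |boolReal f x| ≤ 1 := by
  rw [abs_of_nonneg (boolReal_nonneg f x)]; exact boolReal_le_one f x

theorem fourierCoeff2_eq {n : ℕ} (f : BoolFun n) (α : Cube n) :
    fourierCoeff2 f α = walsh (boolReal f) α := fourierCoeff2_eq_walsh f α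

theorem exists_walsh_eq_minFourier {n : ℕ} (f : BoolFun n) :
    ∃ α, walsh (boolReal f) α = minFourier f := by
  obtain ⟨α, hα⟩ := exists_eq_ciInf_of_finite (f := fourierCoeff2 f)
  exact ⟨α, by rw [← fourierCoeff2_eq, hα, minFourier]⟩

theorem minFourier_le_walsh {n : ℕ} (f : BoolFun n) (α : Cube n) :
    minFourier f ≤ walsh (boolReal f) α := by
  rw [← fourierCoeff2_eq]
  exact ciInf_le (Set.finite_range _).bddBelow α

theorem card_large_walsh_mul_sq_le {d : ℕ} {F : Cube d → ℝ} (hF0 : ∀ x, 0 ≤ F x)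
    (hF1 : ∀ x, F x ≤ 1) {γ : ℝ} (hγ : 0 ≤ γ) :
    ((univ.filter fun α => γ ≤ |walsh F α|).card : ℝ) * γ ^ 2 ≤ 1 := by
  refine le_trans ?_ (sum_walsh_sq_le_one hF0 hF1)
  rw [← nsmul_eq_mul, ← sum_const]
  calc ∑ _α ∈ univ.filter (fun α => γ ≤ |walsh F α|), γ ^ 2
      ≤ ∑ α ∈ univ.filter (fun α => γ ≤ |walsh F α|), walsh F α ^ 2 := by
        refine sum_le_sum fun α hα => ?_
        rw [← sq_abs (walsh F α)]
        exact pow_le_pow_left₀ hγ (mem_filter.mp hα).2 2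
    _ ≤ _ := sum_le_sum_of_subset_of_nonneg (filter_subset _ _) fun _ _ _ => sq_nonneg _

/-- The choice γ = ρ²/16, τ = ρ/2 makes the main term exactly 1/16. The collision term K³/τ⁴ has
order ρ^(-16), which dictates the exponent in N; the factor 2^40 makes everything else small. -/
theorem subspaceDefect_bound_le {ρ : ℝ} (hρ : 0 < ρ) (hρ1 : ρ ≤ 1) {N : ℝ}
    (hN : N = 2 ^ 40 / ρ ^ 16) :
    ((ρ ^ 2 / 16) ^ 2 + 7 / N + 2 ^ 9 / ρ ^ 4 * (8 / N)) / (ρ / 2) ^ 4 +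
      (2 ^ 9 / ρ ^ 4 / (ρ / 2) ^ 4 + 1) * ((2 ^ 9 / ρ ^ 4) ^ 2 * (12 / N)) +
        2 ^ 9 / ρ ^ 4 * (12 / N) / ρ ^ 2 ≤ 1 / 3 := by
  have e : ((ρ ^ 2 / 16) ^ 2 + 7 / N + 2 ^ 9 / ρ ^ 4 * (8 / N)) / (ρ / 2) ^ 4 +
      (2 ^ 9 / ρ ^ 4 / (ρ / 2) ^ 4 + 1) * ((2 ^ 9 / ρ ^ 4) ^ 2 * (12 / N)) +
        2 ^ 9 / ρ ^ 4 * (12 / N) / ρ ^ 2 =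
      1 / 16 + 112 * ρ ^ 12 / 2 ^ 40 + 2 ^ 16 * ρ ^ 8 / 2 ^ 40 +
        (2 ^ 13 + ρ ^ 8) * 12 * 2 ^ 18 / 2 ^ 40 + 12 * 2 ^ 9 * ρ ^ 10 / 2 ^ 40 := by
    rw [hN]; field_simp; ring
  rw [e]
  have h8 : ρ ^ 8 ≤ 1 := pow_le_one₀ hρ.le hρ1
  have h10 : ρ ^ 10 ≤ 1 := pow_le_one₀ hρ.le hρ1
  have h12 : ρ ^ 12 ≤ 1 := pow_le_one₀ hρ.le hρ1
  linarith

/-- The quality of a random subspace of size `2 ^ 40 / ρ ^ 16` is controlled by a nonnegative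
random variable of small mean. -/
theorem exists_defect {n t : ℕ} (f : BoolFun n) {ρ : ℝ} (hρ : 0 < ρ) (hρ1 : ρ ≤ 1) (ht : 3 ≤ t)
    (hN : (2 : ℝ) ^ t = 2 ^ 40 / ρ ^ 16) :
    ∃ U : Matrix (Fin n) (Fin t) (ZMod 2) → ℝ, (∀ X, 0 ≤ U X) ∧ 𝔼 X, U X ≤ 1 / 3 ∧
      ∀ X, U X < 1 →
        |walshRestrict (boolReal f) X 0 - walsh (boolReal f) 0| ≤ ρ ∧
        (∀ α, minFourier f - ρ ≤ walshRestrict (boolReal f) X α) ∧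
        ∃ α, walshRestrict (boolReal f) X α ≤ minFourier f + ρ := by
  classical
  obtain ⟨α₀, hα₀⟩ := exists_walsh_eq_minFourier f
  have hF0 := boolReal_nonneg f
  have hF1 := boolReal_le_one f
  have hF := abs_boolReal_le_one f
  set γ := ρ ^ 2 / 16 with hγdef
  have hγ : 0 < γ := by positivity
  set L := univ.filter fun α => γ ≤ |walsh (boolReal f) α|
  -- Both 0 and the minimizer `α₀` need accurate estimates even if their coefficients are small.
  set Z : Finset (Cube n) := insert 0 (insert α₀ L) with hZdef
  have hZγ : ∀ α ∉ Z, |walsh (boolReal f) α| ≤ γ := by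
    intro α hα
    by_contra h
    exact hα (mem_insert_of_mem (mem_insert_of_mem (mem_filter.mpr ⟨mem_univ _, (not_le.mp h).le⟩)))
  have hK : (Z.card : ℝ) ≤ 2 ^ 9 / ρ ^ 4 := by
    have h1 : (Z.card : ℝ) ≤ L.card + 1 + 1 := by
      exact_mod_cast (card_insert_le _ _).trans (Nat.add_le_add_right (card_insert_le _ _) 1)
    have h2 : (L.card : ℝ) * γ ^ 2 ≤ 1 := card_large_walsh_mul_sq_le hF0 hF1 hγ.le
    have h3 : (L.card : ℝ) ≤ 1 / γ ^ 2 := by rwa [le_div_iff₀ (by positivity)]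
    have h4 : 1 / γ ^ 2 = 2 ^ 8 * (1 / ρ ^ 4) := by rw [hγdef]; field_simp; norm_num
    have h5 : 1 ≤ 1 / ρ ^ 4 := by
      rw [le_div_iff₀ (by positivity), one_mul]; exact pow_le_one₀ hρ.le hρ1
    have h6 : 2 ^ 9 / ρ ^ 4 = 2 ^ 9 * (1 / ρ ^ 4) := by ring
    rw [h6]; linarith
  refine ⟨subspaceDefect (boolReal f) Z (2 ^ 9 / ρ ^ 4) (ρ / 2) ρ,
    fun X => subspaceDefect_nonneg hF hK,
    (expect_subspaceDefect_le ht hF0 hF1 hZγ hK).trans (subspaceDefect_bound_le hρ hρ1 hN),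
    fun X hX => ⟨abs_walshRestrict_sub_le hF hρ hK hX (mem_insert_self _ _), fun α => ?_, α₀, ?_⟩⟩
  · rcases exists_mem_eq_or_abs_walshRestrict_le hF (by positivity) hK hX α with
      ⟨β, hβ, hβα⟩ | ⟨hα, hsmall⟩
    · have h1 := abs_le.mp (abs_walshRestrict_sub_le hF hρ hK hX hβ)
      have h2 := minFourier_le_walsh f β
      rw [← hβα]; linarith
    -- Here the true coefficient is at most γ ≤ ρ/16, hence so is the minimum, while the empirical
    -- one is at least -ρ/2.
    · have h1 := abs_le.mp hsmall
      have h2 := minFourier_le_walsh f α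
      have h3 := (abs_le.mp (hZγ α hα)).2
      have h4 : γ ≤ ρ / 16 := by rw [hγdef]; nlinarith
      linarith
  · have h1 := abs_le.mp (abs_walshRestrict_sub_le hF hρ hK hX
      (mem_insert_of_mem (mem_insert_self α₀ L)))
    linarith

/-! ### Distances in terms of Fourier coefficients -/

theorem hammingDelta_eq_sum {n : ℕ} (f g : BoolFun n) :
    hammingDelta f g = 𝔼 x, if f x ≠ g x then (1 : ℝ) else 0 := by
  classical
  rw [hammingDelta, Fintype.expect_eq_sum_div_card, card_cube, Nat.card_eq_fintype_card,
    Fintype.card_subtype, sum_boole]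
  simp

/-- (1 + χ_α)/2 is the indicator of α · x = 0. -/
theorem boolReal_avg_add {n : ℕ} (f : BoolFun n) (α : Cube n) :
    (walsh (boolReal f) 0 + walsh (boolReal f) α) / 2 =
      𝔼 x, if f x = true ∧ α ⬝ᵥ x = 0 then (1 : ℝ) else 0 := by
  rw [walsh, walsh, ← expect_add_distrib, expect_div]
  refine expect_congr rfl fun x _ => ?_
  rw [zero_dotProduct, signChar_zero, boolReal]
  rcases zmod2_eq_zero_or_one (α ⬝ᵥ x) with h | h <;> by_cases hf : f x = true <;>
    simp [h, hf, signChar_zero, signChar_one]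

/-- Linear duality: an odd cycle is a way to write (0, 1) as a sum of vectors (x, 1) with g x = 1.
If there is none, a functional vanishing on their span separates (0, 1) from it. -/
theorem oddCycleFree_iff {n : ℕ} (g : BoolFun n) :
    OddCycleFree g ↔ ∃ α : Cube n, ∀ x, g x = true → α ⬝ᵥ x = 1 := by
  constructor
  · intro h
    let p : Submodule (ZMod 2) (Cube n × ZMod 2) :=
      { carrier := {v | ∃ k, ∃ x : Fin k → Cube n, (∀ i, g (x i) = true) ∧
          v = (∑ i, x i, (k : ZMod 2))}
        zero_mem' := ⟨0, Fin.elim0, fun i => i.elim0, by ext <;> simp⟩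
        add_mem' := by
          rintro _ _ ⟨k, x, hx, rfl⟩ ⟨l, y, hy, rfl⟩
          refine ⟨k + l, Fin.append x y, fun i => ?_, ?_⟩
          · refine Fin.addCases (fun i => ?_) (fun i => ?_) i
            · rw [Fin.append_left]; exact hx i
            · rw [Fin.append_right]; exact hy i
          · simp [Fin.sum_univ_add]
        smul_mem' := by
          rintro c _ ⟨k, x, hx, rfl⟩
          rcases zmod2_eq_zero_or_one c with rfl | rfl
          · exact ⟨0, Fin.elim0, fun i => i.elim0, by ext <;> simp⟩
          · exact ⟨k, x, hx, by simp⟩ }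
    have hp : ((0, 1) : Cube n × ZMod 2) ∉ p := by
      rintro ⟨k, x, hx, hv⟩
      rw [Prod.mk.injEq] at hv
      exact h k (ZMod.natCast_eq_one_iff_odd.mp hv.2.symm) ⟨x, hv.1.symm, hx⟩
    obtain ⟨φ, hφ, hpφ⟩ := Submodule.exists_le_ker_of_notMem hp
    have hφ1 : φ (0, 1) = 1 := (zmod2_eq_zero_or_one _).resolve_left hφ
    let ψ : Module.Dual (ZMod 2) (Cube n) := φ ∘ₗ LinearMap.inl (ZMod 2) (Cube n) (ZMod 2)
    refine ⟨(dotProductEquiv (ZMod 2) (Fin n)).symm ψ, fun x hx => ?_⟩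
    have h1 : (dotProductEquiv (ZMod 2) (Fin n)).symm ψ ⬝ᵥ x = ψ x := by
      conv_rhs => rw [← (dotProductEquiv (ZMod 2) (Fin n)).apply_symm_apply ψ]
      rfl
    have h2 : φ (x, 1) = 0 := hpφ ⟨1, fun _ => x, fun _ => hx, by simp⟩
    have h3 : φ (x, 1) = ψ x + φ (0, 1) := by
      rw [LinearMap.comp_apply, ← map_add]; simp
    rw [h1]
    rw [h2, hφ1] at h3
    exact (CharTwo.add_eq_zero.mp h3.symm)
  · rintro ⟨α, hα⟩ k hk ⟨x, hx0, hx⟩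
    have h1 : α ⬝ᵥ ∑ i, x i = (k : ZMod 2) := by
      rw [dotProduct_sum]; simp [hα _ (hx _)]
    rw [hx0, dotProduct_zero, ZMod.natCast_eq_one_iff_odd.mpr hk] at h1
    exact zero_ne_one h1

theorem isLinearFun_iff {n : ℕ} (g : BoolFun n) :
    IsLinearFun g ↔ ∃ α : Cube n, ∀ x, g x = decide (α ⬝ᵥ x = 1) := by
  have hb : ∀ a b : ZMod 2, decide (a + b = 1) = xor (decide (a = 1)) (decide (b = 1)) := by
    decide
  constructor
  · intro h
    let e : Bool → ZMod 2 := fun b => if b = true then 1 else 0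
    have he : ∀ b c, e (xor b c) = e b + e c := by decide
    have h0 : g 0 = false := by
      have := h 0 0
      rw [add_zero, Bool.xor_self] at this
      exact this
    let φ : Cube n →+ ZMod 2 :=
      { toFun := fun x => e (g x)
        map_zero' := by simp [h0, e]
        map_add' := fun x y => by rw [h, he] }
    let ψ : Module.Dual (ZMod 2) (Cube n) := φ.toZModLinearMap 2
    refine ⟨(dotProductEquiv (ZMod 2) (Fin n)).symm ψ, fun x => ?_⟩
    have h1 : (dotProductEquiv (ZMod 2) (Fin n)).symm ψ ⬝ᵥ x = ψ x := by
      conv_rhs => rw [← (dotProductEquiv (ZMod 2) (Fin n)).apply_symm_apply ψ]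
      rfl
    have h2 : ψ x = e (g x) := rfl
    have h3 : ∀ b, b = decide (e b = 1) := by decide
    rw [h1, h2]
    exact h3 _
  · rintro ⟨α, hα⟩ x y
    rw [hα, hα, hα, dotProduct_add, hb]

theorem distTo_le {n : ℕ} {P : Set (BoolFun n)} {g : BoolFun n} (hg : g ∈ P) (f : BoolFun n) :
    distTo P f ≤ hammingDelta f g :=
  ciInf_le (f := fun g : P => hammingDelta f g) (Set.finite_range _).bddBelow ⟨g, hg⟩

theorem le_distTo {n : ℕ} {P : Set (BoolFun n)} (hP : P.Nonempty) {f : BoolFun n} {c : ℝ}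
    (h : ∀ g ∈ P, c ≤ hammingDelta f g) : c ≤ distTo P f :=
  haveI := hP.to_subtype
  le_ciInf fun g => h g g.2

/-- The distance to odd-cycle-freeness is determined by the density and the smallest Fourier
coefficient. -/
theorem distOCF_eq {n : ℕ} (f : BoolFun n) :
    distOCF f = (walsh (boolReal f) 0 + minFourier f) / 2 := by
  apply le_antisymm
  · obtain ⟨α, hα⟩ := exists_walsh_eq_minFourier f
    rw [← hα, boolReal_avg_add]
    -- Delete the points of f on α · x = 0; for the lower bound, every such point has to be deleted.
    let g : BoolFun n := fun x => f x && decide (α ⬝ᵥ x = 1)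
    have hg : OddCycleFree g :=
      (oddCycleFree_iff g).mpr ⟨α, fun x hx => by simpa using (Bool.and_eq_true_iff.mp hx).2⟩
    refine (distTo_le (P := {g | OddCycleFree g}) hg f).trans ?_
    rw [hammingDelta_eq_sum]
    refine expect_le_expect fun x _ => ?_
    rcases zmod2_eq_zero_or_one (α ⬝ᵥ x) with h | h <;> by_cases hf : f x = true <;>
      simp [g, h, hf]
  · have hne : OddCycleFree fun _ : Cube n => false := (oddCycleFree_iff _).mpr ⟨0, by simp⟩
    refine le_distTo (P := {g | OddCycleFree g}) ⟨_, Set.mem_ofPred.mpr hne⟩ fun g hg => ?_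
    obtain ⟨α, hα⟩ := (oddCycleFree_iff g).mp hg
    have h1 := minFourier_le_walsh f α
    have h2 : (walsh (boolReal f) 0 + walsh (boolReal f) α) / 2 ≤ hammingDelta f g := by
      rw [boolReal_avg_add, hammingDelta_eq_sum]
      refine expect_le_expect fun x _ => ?_
      by_cases h : f x = true ∧ α ⬝ᵥ x = 0
      · have hgx : g x ≠ true := fun hgx => by
          have := hα x hgx
          rw [h.2] at this
          exact zero_ne_one this
        have : f x ≠ g x := fun he => hgx (he ▸ h.1)
        rw [if_pos h, if_pos this]
      · rw [if_neg h]; split_ifs <;> norm_num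
    linarith

theorem hammingDelta_zero {n : ℕ} (f : BoolFun n) :
    hammingDelta f (fun x => decide ((0 : Cube n) ⬝ᵥ x = 1)) = walsh (boolReal f) 0 := by
  rw [hammingDelta_eq_sum, walsh]
  refine expect_congr rfl fun x _ => ?_
  by_cases hf : f x = true <;> simp [boolReal, hf, signChar_zero]

/-- Disagreement at x equals 1/2 - χ_α(x)/2 + f(x) χ_α(x), and χ_α has mean 0 for α ≠ 0. -/
theorem hammingDelta_linear {n : ℕ} (f : BoolFun n) {α : Cube n} (hα : α ≠ 0) :
    hammingDelta f (fun x => decide (α ⬝ᵥ x = 1)) = 1 / 2 + walsh (boolReal f) α := by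
  have h1 := expect_signChar_dotProduct hα
  have h2 : (1 : ℝ) / 2 = 𝔼 x : Cube n, (1 / 2 - signChar (α ⬝ᵥ x) / 2) := by
    rw [expect_sub_distrib, Fintype.expect_const, ← expect_div, h1]; norm_num
  rw [hammingDelta_eq_sum, h2, walsh, ← expect_add_distrib]
  refine expect_congr rfl fun x _ => ?_
  rcases zmod2_eq_zero_or_one (α ⬝ᵥ x) with h | h <;> by_cases hf : f x = true <;>
    norm_num [h, hf, boolReal, signChar_zero, signChar_one]

/-- The character α = 0 is exceptional: its distance is f̂(0), not 1/2 + f̂(0). Since the latter is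
larger, including α = 0 in the minimum does no harm. -/
theorem distLinear_eq {n : ℕ} (f : BoolFun n) :
    distLinear f = min (walsh (boolReal f) 0) (1 / 2 + minFourier f) := by
  have hlin : ∀ α : Cube n, IsLinearFun fun x => decide (α ⬝ᵥ x = 1) :=
    fun α => (isLinearFun_iff _).mpr ⟨α, fun _ => rfl⟩
  have h0 : distLinear f ≤ walsh (boolReal f) 0 := by
    rw [← hammingDelta_zero]
    exact distTo_le (P := {g | IsLinearFun g}) (hlin 0) f
  apply le_antisymm
  · refine le_min h0 ?_
    obtain ⟨α, hα⟩ := exists_walsh_eq_minFourier f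
    rw [← hα]
    by_cases h : α = 0
    · subst h; linarith
    · rw [← hammingDelta_linear f h]
      exact distTo_le (P := {g | IsLinearFun g}) (hlin α) f
  · refine le_distTo (P := {g | IsLinearFun g}) ⟨_, Set.mem_ofPred.mpr (hlin 0)⟩ fun g hg => ?_
    obtain ⟨α, hα⟩ := (isLinearFun_iff g).mp hg
    obtain rfl : g = fun x => decide (α ⬝ᵥ x = 1) := funext hα
    by_cases h : α = 0
    · subst h; rw [hammingDelta_zero]; exact min_le_left _ _
    · rw [hammingDelta_linear f h]
      exact (min_le_right _ _).trans (by linarith [minFourier_le_walsh f α])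

/-! ### The algorithm -/

theorem Primrec.sum_range {α : Type*} [Primcodable α] {m : α → ℕ} {F : α → ℕ → ℕ}
    (hm : Primrec m) (hF : Primrec fun p : α × ℕ => F p.1 p.2) : Primrec fun a => ∑ i ∈ range (m a), F a i := by
  have h : Primrec fun a => (m a).rec (motive := fun _ => ℕ) 0 fun i s => s + F a i :=
    Primrec.nat_rec' hm (Primrec.const 0)
      (Primrec.nat_add.comp (Primrec.snd.comp Primrec.snd)
        (hF.comp (Primrec.fst.pair (Primrec.fst.comp Primrec.snd)))).to₂
  refine h.of_eq fun a => ?_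
  induction m a with
  | zero => rfl
  | succ k ih => rw [sum_range_succ, ← ih]

theorem Primrec.sup_range {α : Type*} [Primcodable α] {m : α → ℕ} {F : α → ℕ → ℕ}
    (hm : Primrec m) (hF : Primrec fun p : α × ℕ => F p.1 p.2) : Primrec fun a => (range (m a)).sup (F a) := by
  have h : Primrec fun a => (m a).rec (motive := fun _ => ℕ) 0 fun i s => max (F a i) s :=
    Primrec.nat_rec' hm (Primrec.const 0)
      (Primrec.nat_max.comp (hF.comp (Primrec.fst.pair (Primrec.fst.comp Primrec.snd)))
        (Primrec.snd.comp Primrec.snd)).to₂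
  refine h.of_eq fun a => ?_
  induction m a with
  | zero => rfl
  | succ k ih => rw [range_add_one, sup_insert, ← ih]

theorem Primrec.nat_pow : Primrec₂ ((· ^ ·) : ℕ → ℕ → ℕ) :=
  Primrec₂.unpaired'.1 Nat.Primrec.pow

/-- The least `s` with `k ≤ 2 ^ s`. -/
def logCeil : ℕ → ℕ :=
  Nat.rec 0 fun k s => if 2 ^ s < k + 1 then s + 1 else s

theorem logCeil_succ (k : ℕ) :
    logCeil (k + 1) = if 2 ^ logCeil k < k + 1 then logCeil k + 1 else logCeil k := rfl

theorem le_two_pow_logCeil (k : ℕ) : k ≤ 2 ^ logCeil k := by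
  induction k with
  | zero => simp
  | succ k ih =>
    rw [logCeil_succ]
    split_ifs with h
    · have := Nat.one_le_two_pow (n := logCeil k)
      rw [pow_succ]; omega
    · omega

/-- The shift to k + 1 excludes 0, where the factor 2 bound fails. -/
theorem two_pow_logCeil_le (k : ℕ) : 2 ^ logCeil (k + 1) ≤ 2 * (k + 1) := by
  induction k with
  | zero => decide
  | succ k ih =>
    rw [logCeil_succ]
    split_ifs with h
    · rw [pow_succ]; omega
    · omega

theorem primrec_logCeil : Primrec logCeil :=
  Primrec.nat_rec₁ 0 (Primrec.ite
    (Primrec.nat_lt.comp (Primrec.nat_pow.comp (Primrec.const 2) Primrec.snd)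
      (Primrec.succ.comp Primrec.fst))
    (Primrec.succ.comp Primrec.snd) Primrec.snd :)

/-- The dimension of the random subspace, from the accuracy `a / b`. -/
def subspaceDim (a b : ℕ) : ℕ := 40 + 16 * logCeil (b / a + 1)

/-- Coordinate `i` of the `k`-th point of the subspace spanned by the columns of the `t`-column
matrix with entries `w`. -/
def queryBit (t : ℕ) (w : List Bool) (k i : ℕ) : ℕ :=
  (∑ j ∈ range t, (w.getD (j + t * i) false).toNat * (k / 2 ^ j % 2)) % 2

/-- The `k`-th point of the subspace. -/
def queryString (n t : ℕ) (w : List Bool) (k : ℕ) : List Bool :=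
  (List.range n).map fun i => decide (queryBit t w k i = 1)

/-- The number of points of the subspace where the function is true. -/
def trueCount (t : ℕ) (ans : List Bool) : ℕ :=
  ∑ k ∈ range (2 ^ t), (ans.getD k false).toNat

/-- The number of points of the subspace where both the function is true and the linear form with
coefficients the binary digits of `a` is odd. -/
def oddCount (n t : ℕ) (w ans : List Bool) (a : ℕ) : ℕ :=
  ∑ k ∈ range (2 ^ t), (ans.getD k false).toNat *
    ((∑ i ∈ range n, a / 2 ^ i % 2 * queryBit t w k i) % 2)

/-- The largest value of `oddCount` over all linear forms. -/
def maxOddCount (n t : ℕ) (w ans : List Bool) : ℕ :=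
  (range (2 ^ n)).sup (oddCount n t w ans)

/-- The three estimates, from the size `N` of the subspace, the number `K` of points where the
function is true and the largest odd count `M`. -/
def estimates (N K M : ℕ) : RatCode × RatCode × RatCode :=
  ((K, M, N), (K, 2 * M, N), if N ≤ 4 * M then (N + 2 * K, 4 * M, 2 * N) else (K, 0, N))

/-! ### Primitive recursiveness of the estimator -/

section
variable {α : Type*} [Primcodable α] {n t k i a b : α → ℕ} {w ans : α → List Bool}

theorem primrec_subspaceDim (ha : Primrec a) (hb : Primrec b) :
    Primrec fun x => subspaceDim (a x) (b x) :=
  Primrec.nat_add.comp (Primrec.const 40) (Primrec.nat_mul.comp (Primrec.const 16)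
    (primrec_logCeil.comp (Primrec.succ.comp (Primrec.nat_div.comp hb ha))))

theorem primrec_bit (hk : Primrec k) (hi : Primrec i) : Primrec fun x => k x / 2 ^ i x % 2 :=
  Primrec.nat_mod.comp (Primrec.nat_div.comp hk (Primrec.nat_pow.comp (Primrec.const 2) hi))
    (Primrec.const 2)

theorem primrec_getD_toNat (hw : Primrec w) (hi : Primrec i) :
    Primrec fun x => ((w x).getD (i x) false).toNat :=
  (Primrec.dom_bool Bool.toNat).comp ((Primrec.list_getD false).comp hw hi)

theorem primrec_queryBit (ht : Primrec t) (hw : Primrec w) (hk : Primrec k) (hi : Primrec i) :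
    Primrec fun x => queryBit (t x) (w x) (k x) (i x) :=
  Primrec.nat_mod.comp (Primrec.sum_range ht
    (Primrec.nat_mul.comp
      (primrec_getD_toNat (hw.comp Primrec.fst) (Primrec.nat_add.comp Primrec.snd
        (Primrec.nat_mul.comp (ht.comp Primrec.fst) (hi.comp Primrec.fst))))
      (primrec_bit (hk.comp Primrec.fst) Primrec.snd))) (Primrec.const 2)

theorem primrec_queryString (hn : Primrec n) (ht : Primrec t) (hw : Primrec w) (hk : Primrec k) :
    Primrec fun x => queryString (n x) (t x) (w x) (k x) := by
  refine Primrec.list_map (Primrec.list_range.comp hn) ?_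
  have h : PrimrecPred fun p : α × ℕ => queryBit (t p.1) (w p.1) (k p.1) p.2 = 1 :=
    Primrec.eq.comp (primrec_queryBit (ht.comp Primrec.fst) (hw.comp Primrec.fst)
      (hk.comp Primrec.fst) Primrec.snd) (Primrec.const 1)
  exact h.decide

theorem primrec_two_pow (ht : Primrec t) : Primrec fun x => 2 ^ t x :=
  Primrec.nat_pow.comp (Primrec.const 2) ht

theorem primrec_trueCount (ht : Primrec t) (hans : Primrec ans) :
    Primrec fun x => trueCount (t x) (ans x) :=
  Primrec.sum_range (primrec_two_pow ht)
    (primrec_getD_toNat (hans.comp Primrec.fst) Primrec.snd)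

theorem primrec_oddCount (hn : Primrec n) (ht : Primrec t) (hw : Primrec w) (hans : Primrec ans)
    (ha : Primrec a) : Primrec fun x => oddCount (n x) (t x) (w x) (ans x) (a x) :=
  Primrec.sum_range (primrec_two_pow ht)
    (Primrec.nat_mul.comp (primrec_getD_toNat (hans.comp Primrec.fst) Primrec.snd)
      (Primrec.nat_mod.comp (Primrec.sum_range (hn.comp Primrec.fst)
        (Primrec.nat_mul.comp
          (primrec_bit ((ha.comp Primrec.fst).comp Primrec.fst) Primrec.snd)
          (primrec_queryBit ((ht.comp Primrec.fst).comp Primrec.fst)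
            ((hw.comp Primrec.fst).comp Primrec.fst) (Primrec.snd.comp Primrec.fst)
            Primrec.snd))) (Primrec.const 2)))

theorem primrec_maxOddCount (hn : Primrec n) (ht : Primrec t) (hw : Primrec w)
    (hans : Primrec ans) : Primrec fun x => maxOddCount (n x) (t x) (w x) (ans x) :=
  Primrec.sup_range (primrec_two_pow hn)
    (primrec_oddCount (hn.comp Primrec.fst) (ht.comp Primrec.fst) (hw.comp Primrec.fst)
      (hans.comp Primrec.fst) Primrec.snd)

theorem primrec_estimates (hn : Primrec n) (hk : Primrec k) (hi : Primrec i) :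
    Primrec fun x => estimates (n x) (k x) (i x) := by
  have h4 : Primrec fun x => 4 * i x := Primrec.nat_mul.comp (Primrec.const 4) hi
  have h2 : ∀ {f : α → ℕ}, Primrec f → Primrec fun x => 2 * f x :=
    fun hf => Primrec.nat_mul.comp (Primrec.const 2) hf
  exact (hk.pair (hi.pair hn)).pair ((hk.pair ((h2 hi).pair hn)).pair
    (Primrec.ite (Primrec.nat_le.comp hn h4)
      ((Primrec.nat_add.comp hn (h2 hk)).pair (h4.pair (h2 hn)))
      (hk.pair ((Primrec.const 0).pair hn))))

end

/-- Query the function on the whole of a random subspace, then output the estimates. -/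
def estimatorStep (x : AlgInput × List Bool × List Bool) :
    List Bool ⊕ RatCode × RatCode × RatCode :=
  if x.2.2.length < 2 ^ subspaceDim x.1.2.1 x.1.2.2 then
    Sum.inl (queryString x.1.1 (subspaceDim x.1.2.1 x.1.2.2) x.2.1 x.2.2.length)
  else
    Sum.inr (estimates (2 ^ subspaceDim x.1.2.1 x.1.2.2)
      (trueCount (subspaceDim x.1.2.1 x.1.2.2) x.2.2)
      (maxOddCount x.1.1 (subspaceDim x.1.2.1 x.1.2.2) x.2.1 x.2.2))

theorem primrec_estimatorStep : Primrec estimatorStep := by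
  have hn : Primrec fun x : AlgInput × List Bool × List Bool => x.1.1 :=
    Primrec.fst.comp Primrec.fst
  have ht : Primrec fun x : AlgInput × List Bool × List Bool => subspaceDim x.1.2.1 x.1.2.2 :=
    primrec_subspaceDim (Primrec.fst.comp (Primrec.snd.comp Primrec.fst))
      (Primrec.snd.comp (Primrec.snd.comp Primrec.fst))
  have hw : Primrec fun x : AlgInput × List Bool × List Bool => x.2.1 :=
    Primrec.fst.comp Primrec.snd
  have hans : Primrec fun x : AlgInput × List Bool × List Bool => x.2.2 :=
    Primrec.snd.comp Primrec.snd
  have hlen : Primrec fun x : AlgInput × List Bool × List Bool => x.2.2.length :=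
    Primrec.list_length.comp hans
  exact Primrec.ite (Primrec.nat_lt.comp hlen (primrec_two_pow ht))
    (Primrec.sumInl.comp (primrec_queryString hn ht hw hlen))
    (Primrec.sumInr.comp (primrec_estimates (primrec_two_pow ht) (primrec_trueCount ht hans)
      (primrec_maxOddCount hn ht hw hans)))

/-- The simultaneous estimator. -/
def estimator : OracleAlgorithm (RatCode × RatCode × RatCode) where
  coins x := x.1 * subspaceDim x.2.1 x.2.2
  step := estimatorStep
  coins_computable := (Primrec.nat_mul.comp Primrec.fst
    (primrec_subspaceDim (Primrec.fst.comp Primrec.snd)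
      (Primrec.snd.comp Primrec.snd))).to_comp
  step_computable := primrec_estimatorStep.to_comp

/-! ### The run of the estimator -/

/-- The answers to the first `m` queries of the estimator. -/
def answers (n t : ℕ) (w : List Bool) (f : List Bool → Bool) (m : ℕ) : List Bool :=
  (List.range m).map fun k => f (queryString n t w k)

/-- Induction on the remaining queries, the invariant being that the answers so far are those to the
first m points. With q = 0 the step function is still evaluated once, and it then outputs. -/
theorem runFrom_estimator (n a b : ℕ) (w : List Bool) (f : List Bool → Bool) (q m : ℕ)
    (h : m + q = 2 ^ subspaceDim a b) :
    estimator.runFrom (n, a, b) w f q (answers n (subspaceDim a b) w f m) =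
      some (estimates (2 ^ subspaceDim a b)
        (trueCount (subspaceDim a b) (answers n (subspaceDim a b) w f (2 ^ subspaceDim a b)))
        (maxOddCount n (subspaceDim a b) w
          (answers n (subspaceDim a b) w f (2 ^ subspaceDim a b)))) := by
  induction q generalizing m with
  | zero =>
    obtain rfl : m = 2 ^ subspaceDim a b := by omega
    simp [OracleAlgorithm.runFrom, estimator, estimatorStep, answers]
  | succ q ih =>
    have hm : m < 2 ^ subspaceDim a b := by omega
    have hs : estimator.step ((n, a, b), w, answers n (subspaceDim a b) w f m) =
        Sum.inl (queryString n (subspaceDim a b) w m) := by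
      simp [estimator, estimatorStep, answers, hm]
    rw [OracleAlgorithm.runFrom, hs]
    have ha : answers n (subspaceDim a b) w f m ++ [f (queryString n (subspaceDim a b) w m)] =
        answers n (subspaceDim a b) w f (m + 1) := by
      simp [answers, List.range_succ]
    simp only [ha]
    exact ih (m + 1) (by omega)

/-! ### Correctness -/

/-- The matrix whose entries are given by coin tosses. -/
def coinMatrix (n t : ℕ) : (Fin (n * t) → Bool) ≃ Matrix (Fin n) (Fin t) (ZMod 2) :=
  (finProdFinEquiv.symm.arrowCongr finTwoEquiv.symm).trans (Equiv.curry _ _ _)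

theorem coinMatrix_apply {n t : ℕ} (w : Fin (n * t) → Bool) (i : Fin n) (j : Fin t) :
    coinMatrix n t w i j = (((List.ofFn w).getD (j + t * i) false).toNat : ZMod 2) := by
  have h : (j : ℕ) + t * i < n * t := (finProdFinEquiv (i, j)).isLt
  have h1 : ∀ b : Bool, finTwoEquiv.symm b = ((b.toNat : ℕ) : ZMod 2) := by decide
  rw [List.getD_eq_getElem _ _ (by simpa using h), List.getElem_ofFn, ← h1]
  rfl

/-- The vector of binary digits of `k`. -/
def bitVector (t k : ℕ) : Cube t := fun j => ((k / 2 ^ (j : ℕ) % 2 : ℕ) : ZMod 2)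

theorem bitVector_eq (t : ℕ) (k : Fin (2 ^ t)) :
    bitVector t k = (finFunctionFinEquiv.symm k : Fin t → Fin 2) := by
  funext j
  refine Fin.ext ?_
  rw [finFunctionFinEquiv_symm_apply_val]
  have := ZMod.val_natCast 2 ((k : ℕ) / 2 ^ (j : ℕ) % 2)
  rw [Nat.mod_mod] at this
  exact this

theorem bitVector_surjective (t : ℕ) (x : Cube t) : ∃ k < 2 ^ t, bitVector t k = x :=
  ⟨finFunctionFinEquiv (m := 2) x, (finFunctionFinEquiv (m := 2) x).isLt, by
    rw [bitVector_eq]; exact Equiv.symm_apply_apply _ _⟩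

theorem sum_cube_eq_sum_range (t : ℕ) (g : Cube t → ℝ) :
    ∑ y, g y = ∑ k ∈ range (2 ^ t), g (bitVector t k) := by
  rw [← Fin.sum_univ_eq_sum_range (fun k => g (bitVector t k))]
  exact (Fintype.sum_equiv finFunctionFinEquiv.symm _ g fun k => by rw [bitVector_eq]).symm

theorem natCast_queryBit {n t : ℕ} (w : Fin (n * t) → Bool) (k : ℕ) (i : Fin n) :
    (queryBit t (List.ofFn w) k i : ZMod 2) = (coinMatrix n t w).mulVec (bitVector t k) i := by
  rw [queryBit, ZMod.natCast_mod, Matrix.mulVec, dotProduct, ← Fin.sum_univ_eq_sum_range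
    (fun j => (((List.ofFn w).getD (j + t * i) false).toNat * (k / 2 ^ j % 2) : ℕ)) t,
    Nat.cast_sum]
  refine sum_congr rfl fun j _ => ?_
  rw [Nat.cast_mul, coinMatrix_apply, bitVector]

theorem pointOfBits_queryString {n t : ℕ} (w : Fin (n * t) → Bool) (k : ℕ) :
    pointOfBits n (queryString n t (List.ofFn w) k) =
      (coinMatrix n t w).mulVec (bitVector t k) := by
  funext i
  rw [← natCast_queryBit]
  have h : queryBit t (List.ofFn w) k i < 2 := Nat.mod_lt _ (by norm_num)
  have hl : (queryString n t (List.ofFn w) k).getD i false =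
      decide (queryBit t (List.ofFn w) k i = 1) := by
    rw [List.getD_eq_getElem _ _ (by simp [queryString])]
    simp [queryString]
  rw [pointOfBits, hl]
  interval_cases queryBit t (List.ofFn w) k i <;> simp

theorem signChar_eq (a : ZMod 2) : signChar a = 1 - 2 * a.val := by
  rcases zmod2_eq_zero_or_one a with rfl | rfl
  · simp [signChar_zero]
  · rw [signChar_one, ZMod.val_one]; norm_num

theorem parity_eq {n t : ℕ} (w : Fin (n * t) → Bool) (a k : ℕ) :
    (∑ i ∈ range n, a / 2 ^ i % 2 * queryBit t (List.ofFn w) k i) % 2 =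
      (bitVector n a ⬝ᵥ (coinMatrix n t w).mulVec (bitVector t k)).val := by
  rw [← ZMod.val_natCast]
  congr 1
  rw [dotProduct, ← Fin.sum_univ_eq_sum_range
    (fun i => (a / 2 ^ i % 2 * queryBit t (List.ofFn w) k i : ℕ)) n, Nat.cast_sum]
  refine sum_congr rfl fun i _ => ?_
  rw [Nat.cast_mul, natCast_queryBit, bitVector]

section
variable {n t : ℕ} (f : BoolFun n) (w : Fin (n * t) → Bool)

theorem getD_answers {k : ℕ} (hk : k < 2 ^ t) :
    ((((answers n t (List.ofFn w) (fun x => f (pointOfBits n x)) (2 ^ t)).getD k false).toNat : ℕ)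
      : ℝ) = boolReal f ((coinMatrix n t w).mulVec (bitVector t k)) := by
  rw [List.getD_eq_getElem _ _ (by simpa [answers] using hk)]
  simp only [answers, List.getElem_map, List.getElem_range, pointOfBits_queryString, boolReal]
  cases f ((coinMatrix n t w).mulVec (bitVector t k)) <;> simp

/-- Each true point contributes 1 minus twice the parity of the form there; hence the largest odd
count gives the smallest empirical coefficient. -/
theorem walshRestrict_eq_counts (a : ℕ) :
    walshRestrict (boolReal f) (coinMatrix n t w) (bitVector n a) =
      ((trueCount t (answers n t (List.ofFn w) (fun x => f (pointOfBits n x)) (2 ^ t)) : ℝ) -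
        2 * oddCount n t (List.ofFn w)
          (answers n t (List.ofFn w) (fun x => f (pointOfBits n x)) (2 ^ t)) a) / 2 ^ t := by
  rw [walshRestrict, Fintype.expect_eq_sum_div_card, card_cube, sum_cube_eq_sum_range, trueCount,
    oddCount]
  push_cast
  congr 1
  rw [mul_sum, ← sum_sub_distrib]
  refine sum_congr rfl fun k hk => ?_
  rw [getD_answers f w (mem_range.mp hk), signChar_eq, ← parity_eq]
  ring

theorem walshRestrict_zero_eq :
    walshRestrict (boolReal f) (coinMatrix n t w) 0 =
      (trueCount t (answers n t (List.ofFn w) (fun x => f (pointOfBits n x)) (2 ^ t)) : ℝ) /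
        2 ^ t := by
  rw [walshRestrict, Fintype.expect_eq_sum_div_card, card_cube, sum_cube_eq_sum_range, trueCount]
  push_cast
  congr 1
  refine sum_congr rfl fun k hk => ?_
  rw [getD_answers f w (mem_range.mp hk), zero_dotProduct, signChar_zero, mul_one]

theorem maxOddCount_le_walshRestrict (α : Cube n) :
    ((trueCount t (answers n t (List.ofFn w) (fun x => f (pointOfBits n x)) (2 ^ t)) : ℝ) -
        2 * maxOddCount n t (List.ofFn w)
          (answers n t (List.ofFn w) (fun x => f (pointOfBits n x)) (2 ^ t))) / 2 ^ t ≤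
      walshRestrict (boolReal f) (coinMatrix n t w) α := by
  obtain ⟨a, ha, rfl⟩ := bitVector_surjective n α
  rw [walshRestrict_eq_counts]
  have h := le_sup (f := oddCount n t (List.ofFn w)
    (answers n t (List.ofFn w) (fun x => f (pointOfBits n x)) (2 ^ t))) (mem_range.mpr ha)
  have h' : (oddCount n t (List.ofFn w)
    (answers n t (List.ofFn w) (fun x => f (pointOfBits n x)) (2 ^ t)) a : ℝ) ≤
    maxOddCount n t (List.ofFn w)
    (answers n t (List.ofFn w) (fun x => f (pointOfBits n x)) (2 ^ t)) := by exact_mod_cast h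
  gcongr

theorem exists_walshRestrict_eq_maxOddCount :
    ∃ α, walshRestrict (boolReal f) (coinMatrix n t w) α =
      ((trueCount t (answers n t (List.ofFn w) (fun x => f (pointOfBits n x)) (2 ^ t)) : ℝ) -
        2 * maxOddCount n t (List.ofFn w)
          (answers n t (List.ofFn w) (fun x => f (pointOfBits n x)) (2 ^ t))) / 2 ^ t := by
  obtain ⟨a, -, ha⟩ := exists_mem_eq_sup (range (2 ^ n)) ⟨0, by simp⟩
    (oddCount n t (List.ofFn w) (answers n t (List.ofFn w) (fun x => f (pointOfBits n x)) (2 ^ t)))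
  exact ⟨bitVector n a, by rw [walshRestrict_eq_counts, maxOddCount, ha]⟩

end

theorem estimates_correct {n : ℕ} (f : BoolFun n) {N K M : ℕ} (hN : 0 < N) {ε : ℝ}
    (hK : |(K : ℝ) / N - walsh (boolReal f) 0| ≤ ε)
    (hM : |((K : ℝ) - 2 * M) / N - minFourier f| ≤ ε) :
    |RatCode.value (estimates N K M).1 - distOCF f| ≤ ε ∧
      |RatCode.value (estimates N K M).2.1 - minFourier f| ≤ ε ∧
      |RatCode.value (estimates N K M).2.2 - distLinear f| ≤ ε := by
  have hN' : (0 : ℝ) < N := by exact_mod_cast hN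
  refine ⟨?_, ?_, ?_⟩
  · have e : RatCode.value (estimates N K M).1 = ((K : ℝ) / N + ((K : ℝ) - 2 * M) / N) / 2 := by
      simp only [estimates, RatCode.value]; ring
    rw [e, distOCF_eq]
    rw [abs_le] at *
    constructor <;> linarith
  · simpa [estimates, RatCode.value] using hM
  · have e : RatCode.value (estimates N K M).2.2 =
        min ((K : ℝ) / N) (1 / 2 + ((K : ℝ) - 2 * M) / N) := by
      simp only [estimates]
      split_ifs with h
      · have h' : (N : ℝ) ≤ 4 * M := by exact_mod_cast h
        have e1 : 1 / 2 + ((K : ℝ) - 2 * M) / N = K / N + (N - 4 * M) / (2 * N) := by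
          field_simp; ring
        have h1 : (N - 4 * M : ℝ) / (2 * N) ≤ 0 :=
          div_nonpos_of_nonpos_of_nonneg (by linarith) (by positivity)
        rw [min_eq_right (by rw [e1]; linarith), RatCode.value]
        push_cast; field_simp; ring
      · have h' : (4 * M : ℝ) ≤ N := by exact_mod_cast (not_le.mp h).le
        have e1 : 1 / 2 + ((K : ℝ) - 2 * M) / N = K / N + (N - 4 * M) / (2 * N) := by
          field_simp; ring
        have h1 : 0 ≤ (N - 4 * M : ℝ) / (2 * N) := div_nonneg (by linarith) (by positivity)
        rw [min_eq_left (by rw [e1]; linarith), RatCode.value]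
        simp
    rw [e, distLinear_eq]
    -- The minimum is 1-Lipschitz in the maximum norm, so the error does not grow.
    refine (abs_min_sub_min_le_max _ _ _ _).trans (max_le hK ?_)
    rwa [add_sub_add_left_eq_sub]

theorem estimates_counts_correct {n t : ℕ} (f : BoolFun n) (w : Fin (n * t) → Bool) {ε : ℝ}
    (h0 : |walshRestrict (boolReal f) (coinMatrix n t w) 0 - walsh (boolReal f) 0| ≤ ε)
    (hlow : ∀ α, minFourier f - ε ≤ walshRestrict (boolReal f) (coinMatrix n t w) α)
    (hup : ∃ α, walshRestrict (boolReal f) (coinMatrix n t w) α ≤ minFourier f + ε) :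
    let ans := answers n t (List.ofFn w) (fun x => f (pointOfBits n x)) (2 ^ t)
    let o := estimates (2 ^ t) (trueCount t ans) (maxOddCount n t (List.ofFn w) ans)
    |RatCode.value o.1 - distOCF f| ≤ ε ∧ |RatCode.value o.2.1 - minFourier f| ≤ ε ∧
      |RatCode.value o.2.2 - distLinear f| ≤ ε := by
  obtain ⟨α, hα⟩ := hup
  have hM1 := maxOddCount_le_walshRestrict f w α
  obtain ⟨β, hβ⟩ := exists_walshRestrict_eq_maxOddCount f w
  have hM2 := hlow β
  rw [hβ] at hM2
  rw [walshRestrict_zero_eq] at h0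
  refine estimates_correct f (by positivity) ?_ ?_
  · push_cast
    exact h0
  · push_cast
    rw [abs_le]
    constructor <;> linarith

/-! ### Success probability and query bound -/

/-- Markov's inequality for coin tosses. -/
theorem two_thirds_le_coinProb {O : Type} [Primcodable O] (A : OracleAlgorithm O) (inp : AlgInput)
    {E : (Fin (A.coins inp) → Bool) → Prop} (U : (Fin (A.coins inp) → Bool) → ℝ)
    (hU0 : ∀ w, 0 ≤ U w) (hU : 𝔼 w, U w ≤ 1 / 3) (hE : ∀ w, U w < 1 → E w) :
    2 / 3 ≤ A.coinProb inp E := by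
  classical
  have h1 : A.coinProb inp E = 𝔼 w, if E w then (1 : ℝ) else 0 := by
    rw [OracleAlgorithm.coinProb, Fintype.expect_eq_sum_div_card, Nat.card_eq_fintype_card,
      Fintype.card_subtype, sum_boole]
    simp
  -- Pointwise, 1 - U is at most the indicator of E.
  have h2 : 𝔼 w, (1 - U w) ≤ 𝔼 w, if E w then (1 : ℝ) else 0 := by
    refine expect_le_expect fun w _ => ?_
    split_ifs with h
    · linarith [hU0 w]
    · have : ¬ U w < 1 := fun hw => h (hE w hw)
      linarith
  rw [expect_sub_distrib, Fintype.expect_const] at h2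
  rw [h1]; linarith

/-- The bounds on the resolution chosen by the estimator. -/
theorem resolution_bounds {ε : ℝ} (hε : 0 < ε) (hε1 : ε < 1) {a b : ℕ}
    (h1 : ε / 2 ≤ (a : ℝ) / b) (h2 : (a : ℝ) / b ≤ ε) :
    1 / ε ≤ 2 ^ logCeil (b / a + 1) ∧ (2 : ℝ) ^ logCeil (b / a + 1) ≤ 6 * (1 / ε) := by
  have hab : 0 < (a : ℝ) / b := by linarith
  have ha : (0 : ℝ) < a := by
    rcases (Nat.cast_nonneg (α := ℝ) a).lt_or_eq with h | h
    · exact h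
    · rw [← h] at hab; simp at hab
  have hb : (0 : ℝ) < b := by
    rcases (Nat.cast_nonneg (α := ℝ) b).lt_or_eq with h | h
    · exact h
    · rw [← h] at hab; simp at hab
  have e : (b : ℝ) / a = 1 / ((a : ℝ) / b) := by field_simp
  constructor
  · have h3 : 1 / ε ≤ (b : ℝ) / a := by rw [e]; exact one_div_le_one_div_of_le hab h2
    have h4 : (b : ℝ) / a < ((b / a + 1 : ℕ) : ℝ) := by
      rw [div_lt_iff₀ ha]
      have : b < (b / a + 1) * a := by
        rw [mul_comm]; exact Nat.lt_mul_div_succ b (by exact_mod_cast ha)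
      exact_mod_cast this
    have h5 : ((b / a + 1 : ℕ) : ℝ) ≤ 2 ^ logCeil (b / a + 1) := by
      exact_mod_cast le_two_pow_logCeil (b / a + 1)
    linarith
  · have h3 : (b : ℝ) / a ≤ 2 * (1 / ε) := by
      rw [e]
      refine (one_div_le_one_div_of_le (by linarith) h1).trans (le_of_eq ?_)
      field_simp
    have h4 : ((b / a : ℕ) : ℝ) ≤ (b : ℝ) / a := Nat.cast_div_le
    have h5 : (2 : ℝ) ^ logCeil (b / a + 1) ≤ 2 * (((b / a : ℕ) : ℝ) + 1) := by
      exact_mod_cast two_pow_logCeil_le (b / a)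
    -- This absorbs the rounding: 2(2/ε + 1) ≤ 6/ε.
    have h6 : 1 ≤ 1 / ε := by rw [le_div_iff₀ hε]; linarith
    linarith

theorem two_pow_subspaceDim (a b : ℕ) :
    (2 : ℝ) ^ subspaceDim a b = 2 ^ 40 * (2 ^ logCeil (b / a + 1)) ^ 16 := by
  rw [subspaceDim, pow_add, mul_comm 16, pow_mul]

theorem haltsWith_estimator {n : ℕ} (f : BoolFun n) (a b : ℕ)
    (w : Fin (estimator.coins (n, a, b)) → Bool) :
    estimator.HaltsWith a b f w (2 ^ subspaceDim a b)
      (estimates (2 ^ subspaceDim a b)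
        (trueCount (subspaceDim a b) (answers n (subspaceDim a b) (List.ofFn w)
          (fun x => f (pointOfBits n x)) (2 ^ subspaceDim a b)))
        (maxOddCount n (subspaceDim a b) (List.ofFn w) (answers n (subspaceDim a b) (List.ofFn w)
          (fun x => f (pointOfBits n x)) (2 ^ subspaceDim a b)))) :=
  runFrom_estimator n a b (List.ofFn w) _ (2 ^ subspaceDim a b) 0 (zero_add _)

end

theorem theorem2 :
    ∃ (A : OracleAlgorithm (RatCode × RatCode × RatCode)) (p : Polynomial ℝ),
      ∀ (n : ℕ) (f : BoolFun n) (ε : ℝ), 0 < ε → ε < 1 →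
        -- the algorithm receives `ε` as a fraction `a / b`: `ε` itself if `ε` is rational,
        -- and for any real `ε` a rational lower approximation up to a factor of `2`
        ∀ a b : ℕ, ε / 2 ≤ (a : ℝ) / (b : ℝ) → (a : ℝ) / (b : ℝ) ≤ ε →
          -- it always halts, after at most `poly(1/ε)` queries
          (∀ w : Fin (A.coins (n, a, b)) → Bool, ∃ (q : ℕ) (o : RatCode × RatCode × RatCode),
            (q : ℝ) ≤ p.eval (1 / ε) ∧ A.HaltsWith a b f w q o) ∧
          -- with probability at least `2/3` all its estimates are correct within `± ε`
          2 / 3 ≤ A.coinProb (n, a, b) (fun w =>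
            ∃ (q : ℕ) (o : RatCode × RatCode × RatCode), A.HaltsWith a b f w q o ∧
              |RatCode.value o.1 - distOCF f| ≤ ε ∧
              |RatCode.value o.2.1 - minFourier f| ≤ ε ∧
              |RatCode.value o.2.2 - distLinear f| ≤ ε) := by
  -- The query count is 2^40 (2^s)^16 with 2^s ≤ 6/ε. The analysis runs at accuracy ρ = 2^(-s) ≤ ε,
  -- so that 2^40/ρ^16 is exactly a power of two.
  refine ⟨estimator, Polynomial.C (2 ^ 40 * 6 ^ 16) * Polynomial.X ^ 16, ?_⟩
  intro n f ε hε hε1 a b hab1 hab2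
  obtain ⟨hs1, hs2⟩ := resolution_bounds hε hε1 hab1 hab2
  refine ⟨fun w => ⟨2 ^ subspaceDim a b, _, ?_, haltsWith_estimator f a b w⟩, ?_⟩
  · rw [Nat.cast_pow, Nat.cast_ofNat, two_pow_subspaceDim, Polynomial.eval_mul, Polynomial.eval_C,
      Polynomial.eval_pow, Polynomial.eval_X, mul_assoc, ← mul_pow]
    gcongr
  · set s := logCeil (b / a + 1) with hs
    have h2s : (1 : ℝ) ≤ 2 ^ s := one_le_pow₀ (by norm_num)
    have hρ : (0 : ℝ) < 1 / 2 ^ s := by positivity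
    have hρ1 : 1 / (2 : ℝ) ^ s ≤ 1 := by rw [div_le_one (by positivity)]; exact h2s
    have hρε : 1 / (2 : ℝ) ^ s ≤ ε := by
      rw [div_le_iff₀ (by positivity)]
      rwa [div_le_iff₀ hε, mul_comm] at hs1
    have hN : (2 : ℝ) ^ subspaceDim a b = 2 ^ 40 / (1 / 2 ^ s) ^ 16 := by
      rw [two_pow_subspaceDim, one_div, inv_pow, div_inv_eq_mul]
    obtain ⟨U, hU0, hU, hgood⟩ := exists_defect f hρ hρ1
      (show 3 ≤ subspaceDim a b by rw [subspaceDim]; omega) hN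
    refine two_thirds_le_coinProb estimator (n, a, b)
      (fun w => U (coinMatrix n (subspaceDim a b) w)) (fun w => hU0 _) ?_ fun w hw => ?_
    · refine le_of_eq_of_le ?_ hU
      exact Fintype.expect_equiv (coinMatrix n (subspaceDim a b)) _ _ fun _ => rfl
    · refine ⟨_, _, haltsWith_estimator f a b w, ?_⟩
      obtain ⟨h0, hlow, hα⟩ := hgood _ hw
      exact estimates_counts_correct f w (h0.trans hρε)
        (fun α => by linarith [hlow α]) (hα.imp fun α h => by linarith)
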